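/- Let $N<M$, let $k_1<\dots<k_M$ and $\theta_{01},\dots,\theta_{0M}$ be real, and put $\theta_m=k_mx+k_m^2y+k_m^3t+\theta_{0m}$. Assume that $k_1,\dots,k_M$ are generic, in the sense that the sums $k_i+k_j$ $(i<j)$ are pairwise different. Let $A$ be a real $N\times M$ matrix of rank $N$ in reduced row-echelon form, all of whose nonzero $N\times N$ minors $A(m_1,\dots,m_N)$ $(m_1<\dots<m_N)$ are positive, and which is irreducible: each column of $A$ has a nonzero entry, and each row has a nonzero entry besides its pivot. Let $$\tau(x,y,t)=\sum_{1\le m_1<\dots<m_N\le M}A(m_1,\dots,m_N)\,e^{\theta_{m_1}+\dots+\theta_{m_N}}\prod_{1\le s<r\le N}(k_{m_r}-k_{m_s}),\qquad u=2(\log\tau)_{xx}.$$ For real $p<q$, say that $u$ contains the line soliton $(p,q)$ as $y\to\infty$ if there is a constant $\delta\in\mathbb R$ such that, with $\vartheta=(q-p)x+(q^2-p^2)y+(q^3-p^3)t+\delta$, for each fixed $t$ and each $R$ one has $u-\tfrac12(q-p)^2\operatorname{sech}^2(\tfrac12\vartheta)\to0$ as $y\to\infty$, uniformly on the strip $|\vartheta|\le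 R$ in the $(x,y)$-plane. For $i<j$, say that $[i,j]$ is an asymptotic line soliton as $y\to\infty$ if $u$ contains the line soliton $(k_i,k_j)$ as $y\to\infty$ and it arises from a single-phase transition $i\to j$: there is a set $S$ of $N-1$ indices, containing neither $i$ nor $j$, such that the terms of $\tau$ with index sets $S\cup\{i\}$ and $S\cup\{j\}$ are nonzero and, for each fixed $t$ and each $R$, the quotient of $\tau$ by the sum of these two terms tends to $1$ as $y\to\infty$, uniformly on $|\theta_i-\theta_j|\le R$. The same notions as $y\to-\infty$ are defined in the same way. Then the following hold. (i) Each line soliton contained in $u$ as $y\to\infty$ is $(k_i,k_j)$ for a unique asymptotic line soliton $[i,j]$ as $y\to\infty$. For each of these $i$ is a pivot column of $A$, and for each pivot column $e$ there is exactly one $j$ such that $[e,j]$ is one of them; there are exactly $N_+=N$ of them. Likewise, each line soliton contained in $u$ as $y\to-\infty$ is $(k_i,k_j)$ for a unique asymptotic line soliton $[i,j]$ as $y\to-\infty$. For each of these $j$ is a non-pivot column of $A$, and for each non-pivot column $g$ there is exactly one $i$ such that $[i,g]$ is one of them; there are exactly $N_-=M-N$ of them. (ii) For $i<j$ let $X_{ij}$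 be the submatrix of $A$ formed by the columns $1,\dots,i-1,j+1,\dots,M$, let $Y_{ij}$ be the submatrix formed by the columns $i+1,\dots,j-1$, and let $(Z|m)$ and $(Z|m,n)$ denote $Z$ augmented by the indicated columns of $A$. Then $[i,j]$ is an asymptotic line soliton as $y\to\infty$ if and only if $r:=\operatorname{rank}X_{ij}\le N-1$ and $$\operatorname{rank}(X_{ij}|i)=\operatorname{rank}(X_{ij}|j)=\operatorname{rank}(X_{ij}|i,j)=r+1,$$ and $[i,j]$ is an asymptotic line soliton as $y\to-\infty$ if and only if $s:=\operatorname{rank}Y_{ij}\le N-1$ and $$\operatorname{rank}(Y_{ij}|i)=\operatorname{rank}(Y_{ij}|j)=\operatorname{rank}(Y_{ij}|i,j)=s+1.$$ -/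

import Mathlib

open Filter Topology

namespace KPII

noncomputable section

/-- The phase `θ_m = k_m x + k_m² y + k_m³ t + θ_{0m}`. -/
def phase {M : ℕ} (k θ₀ : Fin M → ℝ) (m : Fin M) (x y t : ℝ) : ℝ :=
  k m * x + k m ^ 2 * y + k m ^ 3 * t + θ₀ m

/-- The `N × N` minor `A(m_1, …, m_N)` on the columns `m_1 < … < m_N`. -/
def minor {N M : ℕ} (A : Matrix (Fin N) (Fin M) ℝ) (m : Fin N ↪o Fin M) : ℝ :=
  (A.submatrix id m).det

/-- One term of the exponential sum:
`A(m_1, …, m_N) exp(θ_{m_1} + ⋯ + θ_{m_N}) ∏_{s < r} (k_{m_r} - k_{m_s})`. -/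
def tauTerm {N M : ℕ} (A : Matrix (Fin N) (Fin M) ℝ) (k θ₀ : Fin M → ℝ)
    (m : Fin N ↪o Fin M) (x y t : ℝ) : ℝ :=
  minor A m * Real.exp (∑ n, phase k θ₀ (m n) x y t) *
    ∏ s : Fin N, ∏ r ∈ Finset.Ioi s, (k (m r) - k (m s))

/-- The `τ`-function, the sum of all the terms over `m_1 < … < m_N`. -/
def tau {N M : ℕ} (A : Matrix (Fin N) (Fin M) ℝ) (k θ₀ : Fin M → ℝ) (x y t : ℝ) : ℝ :=
  ∑ m : Fin N ↪o Fin M, tauTerm A k θ₀ m x y t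

/-- The solution `u = 2 (log τ)_{xx}`. -/
def solution {N M : ℕ} (A : Matrix (Fin N) (Fin M) ℝ) (k θ₀ : Fin M → ℝ) (x y t : ℝ) : ℝ :=
  2 * iteratedDeriv 2 (fun x' => Real.log (tau A k θ₀ x' y t)) x

/-- Column `e` holds the pivot (leftmost nonzero entry) of row `n`. -/
def IsPivot {N M : ℕ} (A : Matrix (Fin N) (Fin M) ℝ) (n : Fin N) (e : Fin M) : Prop :=
  A n e ≠ 0 ∧ ∀ m, m < e → A n m = 0

/-- `e` is a pivot column of `A`. -/
def IsPivotColumn {N M : ℕ} (A : Matrix (Fin N) (Fin M) ℝ) (e : Fin M) : Prop :=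
  ∃ n, IsPivot A n e

/-- Reduced row-echelon form. -/
structure IsRREF {N M : ℕ} (A : Matrix (Fin N) (Fin M) ℝ) : Prop where
  zero_rows_last : ∀ n n', n < n' → A n = 0 → A n' = 0
  pivot_lt : ∀ n n' e e', n < n' → IsPivot A n e → IsPivot A n' e' → e < e'
  pivot_eq_one : ∀ n e, IsPivot A n e → A n e = 1
  pivot_column : ∀ n e, IsPivot A n e → ∀ n', n' ≠ n → A n' e = 0

/-- The positive definiteness condition on the phase parameters and the coefficient matrix. -/
structure IsPositive {N M : ℕ} (A : Matrix (Fin N) (Fin M) ℝ) (k : Fin M → ℝ) : Prop where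
  strictMono : StrictMono k
  rank_eq : A.rank = N
  lt : N < M
  minor_pos : ∀ m : Fin N ↪o Fin M, minor A m ≠ 0 → 0 < minor A m

/-- Irreducibility: no column is zero, and each row has a nonzero entry besides its pivot. -/
structure IsIrreducible {N M : ℕ} (A : Matrix (Fin N) (Fin M) ℝ) : Prop where
  column : ∀ m, ∃ n, A n m ≠ 0
  row : ∀ n, ∃ e m, IsPivot A n e ∧ m ≠ e ∧ A n m ≠ 0

/-- Generic phase parameters: the directions `k_i + k_j` of the lines `θ_i = θ_j` belonging
to different pairs `i < j` are different. -/
def IsGeneric {M : ℕ} (k : Fin M → ℝ) : Prop :=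
  ∀ i j i' j', i < j → i' < j' → k i + k j = k i' + k j' → i = i' ∧ j = j'

/-- The points `(x, y)` of the strip `|ϑ x y| ≤ R`, with `y` tending along `F`
(`atTop` for `y → ∞`, `atBot` for `y → -∞`). -/
def strip (F : Filter ℝ) (ϑ : ℝ → ℝ → ℝ) (R : ℝ) : Filter (ℝ × ℝ) :=
  comap Prod.snd F ⊓ 𝓟 {z | |ϑ z.1 z.2| ≤ R}

/-- `θ_q - θ_p`, for real phase parameters `p`, `q`, up to the constant `δ`. -/
def phaseDiff (p q δ x y t : ℝ) : ℝ :=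
  (q - p) * x + (q ^ 2 - p ^ 2) * y + (q ^ 3 - p ^ 3) * t + δ

/-- As `y` tends along `F`, the function `u` contains the line soliton with phase parameters
`p < q`: for each fixed `t`, in strips of any width around the line, `u` is asymptotic to the
travelling wave `½ (q - p)² sech² (½ (θ_q - θ_p))`, whose position is fixed by a constant `δ`. -/
def HasLineSoliton (u : ℝ → ℝ → ℝ → ℝ) (F : Filter ℝ) (p q : ℝ) : Prop :=
  p < q ∧ ∃ δ : ℝ, ∀ t R : ℝ,
    Tendsto (fun z : ℝ × ℝ => u z.1 z.2 t -
        (q - p) ^ 2 / 2 * (1 / Real.cosh (phaseDiff p q δ z.1 z.2 t / 2)) ^ 2)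
      (strip F (fun x y => phaseDiff p q δ x y t) R) (𝓝 0)

/-- The single-phase transition `i → j` occurs as `y` tends along `F`: for each fixed `t`, in
strips of any width around `θ_i = θ_j`, the `τ`-function is asymptotic to the sum of its two
nonzero terms with phase combinations `θ(i, m_2, …, m_N)` and `θ(j, m_2, …, m_N)`; here
`S = {m_2, …, m_N}`. -/
def IsSinglePhaseTransition {N M : ℕ} (A : Matrix (Fin N) (Fin M) ℝ) (k θ₀ : Fin M → ℝ)
    (F : Filter ℝ) (i j : Fin M) : Prop :=
  ∃ (S : Set (Fin M)) (a b : Fin N ↪o Fin M),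
    i ∉ S ∧ j ∉ S ∧ Set.range a = insert i S ∧ Set.range b = insert j S ∧
    minor A a ≠ 0 ∧ minor A b ≠ 0 ∧
    ∀ t R : ℝ, Tendsto
      (fun z : ℝ × ℝ => tau A k θ₀ z.1 z.2 t /
        (tauTerm A k θ₀ a z.1 z.2 t + tauTerm A k θ₀ b z.1 z.2 t))
      (strip F (fun x y => phase k θ₀ i x y t - phase k θ₀ j x y t) R) (𝓝 1)

/-- `[i, j]`, `i < j`, labels an asymptotic line soliton as `y` tends along `F`. -/
def IsAsymptoticLineSoliton {N M : ℕ} (A : Matrix (Fin N) (Fin M) ℝ) (k θ₀ : Fin M → ℝ)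
    (F : Filter ℝ) (i j : Fin M) : Prop :=
  i < j ∧ IsSinglePhaseTransition A k θ₀ F i j ∧
    HasLineSoliton (solution A k θ₀) F (k i) (k j)

/-- The rank of the submatrix of `A` formed by the columns in `Z`. -/
def colRank {N M : ℕ} (A : Matrix (Fin N) (Fin M) ℝ) (Z : Finset (Fin M)) : ℕ :=
  (A.submatrix id (fun m : Z => (m : Fin M))).rank

/-- `rank Z = r ≤ N - 1` and `rank (Z | i) = rank (Z | j) = rank (Z | i, j) = r + 1`. -/
def RankCondition {N M : ℕ} (A : Matrix (Fin N) (Fin M) ℝ) (Z : Finset (Fin M))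
    (i j : Fin M) : Prop :=
  colRank A Z + 1 ≤ N ∧
  colRank A (insert i Z) = colRank A Z + 1 ∧
  colRank A (insert j Z) = colRank A Z + 1 ∧
  colRank A (insert i (insert j Z)) = colRank A Z + 1

/-- The columns `1, …, i - 1, j + 1, …, M`. -/
def outerColumns {M : ℕ} (i j : Fin M) : Finset (Fin M) := Finset.Iio i ∪ Finset.Ioi j

/-- The columns `i + 1, …, j - 1`. -/
def innerColumns {M : ℕ} (i j : Fin M) : Finset (Fin M) := Finset.Ioo i j

end

end KPII

/-! Along a line `x + s y = const` the phase `θ_m` grows like `(k_m² - s k_m) y`. With `σ = 1` for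
`y → ∞` and `σ = -1` for `y → -∞`, give column `m` the weight `σ (k_m² - s k_m)`. A nonzero minor is
a basis of `ℝ^N` made of columns of `A`, so the dominant terms of `τ` are the column bases of
greatest weight. Positivity rules out cancellation, and `solution_eq` writes `u` as a variance with
respect to the normalized terms. Hence `u → 0` in strips along the line if the best basis is unique
(`solution_tendsto_zero`), while two best bases that differ by `i ↔ j` leave exactly a `sech²`
profile (`solution_sub_tendsto_zero`, `exists_soliton_profile`).

Weights tie only when `k_i + k_j = s`, and by genericity for at most one pair. The greedy property
`IsMaxBase.mem_span` makes all best bases agree away from that pair. Two of them exist exactly when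
columns `i` and `j` are each independent of the strictly heavier columns, but not of each other
modulo these (`spanCondition_iff_exists_isMaxBase`). Since the weight of `m` exceeds that of `i` by
`σ (k_m - k_i)(k_m - k_j)`, the heavier columns are the outer ones for `σ = 1` and the inner ones
for `σ = -1`. These are the rank conditions.

Conversely, a soliton contained in `u` has a nonzero peak, which forces its direction to be some
`k_i + k_j`; comparing amplitudes then identifies the two parameters
(`spanCondition_of_hasLineSoliton`). The counts are linear algebra: as the set of columns grows one
at a time, a given column enters the span at exactly one step. -/

namespace KPII

/-! ### Bases of greatest weight and the greedy property. -/

section MaxBase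

variable {ι E : Type*} [AddCommGroup E] [Module ℝ E]

/-- `B` indexes a basis of `E` consisting of members of the family `w`. -/
def IsBase (w : ι → E) (B : Finset ι) : Prop :=
  LinearIndepOn ℝ w (B : Set ι) ∧ B.card = Module.finrank ℝ E

/-- `B` indexes a basis of the greatest weight among those formed by members of `w`. -/
def IsMaxBase (w : ι → E) (v : ι → ℝ) (B : Finset ι) : Prop :=
  IsBase w B ∧ ∀ B', IsBase w B' → ∑ f ∈ B', v f ≤ ∑ f ∈ B, v f

variable {w : ι → E} {v : ι → ℝ} {B B' : Finset ι} {i j : ι}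

open Submodule

/-- `i` and `j` are independent modulo `Z`, but not from each other. -/
def SpanCondition (w : ι → E) (Z : Set ι) (i j : ι) : Prop :=
  w i ∉ span ℝ (w '' Z) ∧ w j ∉ span ℝ (w '' Z) ∧ w j ∈ span ℝ (w '' insert i Z)

theorem IsBase.span_eq_top [FiniteDimensional ℝ E] (hB : IsBase w B) :
    span ℝ (w '' (B : Set ι)) = ⊤ := by
  have h := LinearIndependent.span_eq_top_of_card_eq_finrank' (K := ℝ)
    (b := fun x : (B : Set ι) => w x) hB.1 (by simpa using hB.2)
  rwa [Set.image_eq_range]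

theorem IsBase.of_span_eq_top (h : LinearIndepOn ℝ w (B : Set ι))
    (ht : span ℝ (w '' (B : Set ι)) = ⊤) : IsBase w B := by
  refine ⟨h, ?_⟩
  have := finrank_span_eq_card (R := ℝ) (b := fun x : (B : Set ι) => w x) h
  rw [← Set.image_eq_range, ht, finrank_top] at this
  simpa using this.symm

/-- Greedy property. Otherwise `z` and the members of `B` at least as heavy would be independent,
and would extend inside `B ∪ {z}` to a basis that trades a lighter member of `B` for `z`. -/
theorem IsMaxBase.mem_span [FiniteDimensional ℝ E] (hB : IsMaxBase w v B) (z : ι) :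
    w z ∈ span ℝ (w '' {f | f ∈ B ∧ v z ≤ v f}) := by
  classical
  by_contra hz
  have hzB : z ∉ B := fun h => hz (subset_span ⟨z, ⟨h, le_rfl⟩, rfl⟩)
  have hLB : {f | f ∈ B ∧ v z ≤ v f} ⊆ (B : Set ι) := fun f hf => hf.1
  have hind := (hB.1.1.mono hLB).insert hz
  have hsub : insert z {f | f ∈ B ∧ v z ≤ v f} ⊆ ((insert z B : Finset ι) : Set ι) := by
    rw [Finset.coe_insert]; exact Set.insert_subset_insert hLB
  obtain ⟨C, hC⟩ : ∃ C : Finset ι, (C : Set ι) = hind.extend hsub :=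
    ((insert z B).finite_toSet.subset (hind.extend_subset hsub)).exists_finset_coe
  have hCind : LinearIndepOn ℝ w (C : Set ι) := hC ▸ hind.linearIndepOn_extend hsub
  have hCspan : span ℝ (w '' (C : Set ι)) = ⊤ := by
    rw [hC, hind.span_image_extend_eq_span_image hsub, eq_top_iff, ← hB.1.span_eq_top]
    exact span_mono (Set.image_mono (by simp))
  have hCbase := IsBase.of_span_eq_top hCind hCspan
  have hCsub : C ⊆ insert z B := by
    rw [← Finset.coe_subset, hC]; exact hind.extend_subset hsub
  have hins : insert z {f | f ∈ B ∧ v z ≤ v f} ⊆ (C : Set ι) := by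
    rw [hC]; exact hind.subset_extend hsub
  -- Both bases have the same size, so `C` drops a single element `f` of `B ∪ {z}`; all members at
  -- least as heavy as `z` are kept, so `f` is lighter.
  have hcard : (insert z B \ C).card = 1 := by
    rw [Finset.card_sdiff_of_subset hCsub, Finset.card_insert_of_notMem hzB, hCbase.2, hB.1.2]
    simp
  obtain ⟨f, hf⟩ := Finset.card_eq_one.1 hcard
  have hfm : f ∈ insert z B \ C := by simp [hf]
  rw [Finset.mem_sdiff, Finset.mem_insert] at hfm
  have hzC : z ∈ C := hins (Set.mem_insert _ _)
  have hfB : f ∈ B := hfm.1.resolve_left (fun h => hfm.2 (h ▸ hzC))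
  have hlt : v f < v z := not_le.1 fun h => hfm.2 (hins (Set.mem_insert_of_mem _ ⟨hfB, h⟩))
  have hsum := Finset.sum_sdiff hCsub (f := v)
  rw [hf, Finset.sum_singleton, Finset.sum_insert hzB] at hsum
  have := hB.2 C hCbase
  linarith

theorem IsMaxBase.span_image_lt [FiniteDimensional ℝ E] (hB : IsMaxBase w v B) (c : ℝ) :
    span ℝ (w '' {m | c < v m}) = span ℝ (w '' {f | f ∈ B ∧ c < v f}) := by
  apply le_antisymm
  · rw [span_le]
    rintro _ ⟨m, hm, rfl⟩
    refine span_mono (Set.image_mono ?_) (hB.mem_span m)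
    exact fun f hf => ⟨hf.1, lt_of_lt_of_le hm hf.2⟩
  · exact span_mono (Set.image_mono fun f hf => hf.2)

theorem IsMaxBase.notMem_span [FiniteDimensional ℝ E] (hB : IsMaxBase w v B) {f : ι} (hf : f ∈ B) :
    w f ∉ span ℝ (w '' {m | v f < v m}) := by
  rw [hB.span_image_lt]
  intro h
  refine hB.1.1.notMem_span hf (span_mono (Set.image_mono ?_) h)
  rintro m ⟨hm, hlt⟩
  refine ⟨hm, ?_⟩
  rintro rfl
  exact lt_irrefl _ hlt

/-- The right-hand side does not mention `B`: an element of untied weight lies in all maximal bases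
or in none. -/
theorem IsMaxBase.mem_iff [FiniteDimensional ℝ E] (hB : IsMaxBase w v B) {f : ι}
    (hf : ∀ m, m ≠ f → v m ≠ v f) :
    f ∈ B ↔ w f ∉ span ℝ (w '' {m | v f < v m}) := by
  refine ⟨hB.notMem_span, fun h => ?_⟩
  by_contra hfB
  refine h (span_mono (Set.image_mono ?_) (hB.mem_span f))
  rintro m ⟨hm, hle⟩
  exact lt_of_le_of_ne hle (hf m (fun h => hfB (h ▸ hm))).symm

theorem IsMaxBase.eq_of_injective [FiniteDimensional ℝ E] (hv : Function.Injective v)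
    (hB : IsMaxBase w v B) (hB' : IsMaxBase w v B') : B = B' := by
  ext f
  have hf : ∀ m, m ≠ f → v m ≠ v f := fun m hm h => hm (hv h)
  rw [hB.mem_iff hf, hB'.mem_iff hf]

/-- The only two members of the family of equal weight are `i` and `j`. -/
def TiesOnly (v : ι → ℝ) (i j : ι) : Prop :=
  i ≠ j ∧ v i = v j ∧ ∀ f, f ≠ i → f ≠ j → ∀ m, m ≠ f → v m ≠ v f

theorem TiesOnly.symm (h : TiesOnly v i j) : TiesOnly v j i :=
  ⟨h.1.symm, h.2.1.symm, fun f hi hj => h.2.2 f hj hi⟩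

theorem IsMaxBase.exchange [FiniteDimensional ℝ E] (ht : TiesOnly v i j) (hB : IsMaxBase w v B)
    (hB' : IsMaxBase w v B') (hne : B ≠ B') :
    (i ∈ B ∧ j ∉ B ∧ i ∉ B' ∧ j ∈ B') ∨ (j ∈ B ∧ i ∉ B ∧ j ∉ B' ∧ i ∈ B') := by
  classical
  have key : ∀ f, f ≠ i → f ≠ j → (f ∈ B ↔ f ∈ B') := fun f hi hj => by
    rw [hB.mem_iff (ht.2.2 f hi hj), hB'.mem_iff (ht.2.2 f hi hj)]
  have hcard : B.card = B'.card := hB.1.2.trans hB'.1.2.symm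
  by_cases h : B ⊆ B' ∨ B' ⊆ B
  · rcases h with h | h
    · exact absurd (Finset.eq_of_subset_of_card_le h hcard.ge) hne
    · exact absurd (Finset.eq_of_subset_of_card_le h hcard.le).symm hne
  · push Not at h
    obtain ⟨a, ha, ha'⟩ := Finset.not_subset.1 h.1
    obtain ⟨b, hb, hb'⟩ := Finset.not_subset.1 h.2
    have hai : a = i ∨ a = j := by
      by_contra! hc; exact ha' ((key a hc.1 hc.2).1 ha)
    have hbi : b = i ∨ b = j := by
      by_contra! hc; exact hb' ((key b hc.1 hc.2).2 hb)
    rcases hai with rfl | rfl <;> rcases hbi with rfl | rfl <;> simp_all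

theorem IsMaxBase.sdiff_eq [FiniteDimensional ℝ E] (ht : TiesOnly v i j) (hB : IsMaxBase w v B)
    (hB' : IsMaxBase w v B') : (B : Set ι) \ {i, j} = (B' : Set ι) \ {i, j} := by
  ext f
  simp only [Set.mem_sdiff, Set.mem_insert_iff, Set.mem_singleton_iff, not_or, Finset.mem_coe]
  refine and_congr_left fun h => ?_
  rw [hB.mem_iff (ht.2.2 f h.1 h.2), hB'.mem_iff (ht.2.2 f h.1 h.2)]

/-- A third basis would have to lack `i` by exchange with `B`, and contain `i` by exchange with
`B'`. -/
theorem IsMaxBase.eq_or_eq [FiniteDimensional ℝ E] (ht : TiesOnly v i j) (hB : IsMaxBase w v B)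
    (hB' : IsMaxBase w v B') (hi : i ∈ B) (hi' : i ∉ B') {C : Finset ι}
    (hC : IsMaxBase w v C) : C = B ∨ C = B' := by
  by_contra! h
  have h1 := hC.exchange ht hB h.1
  have h2 := hC.exchange ht hB' h.2
  tauto

/-- Replacing `i` by `j` keeps the weight. It keeps independence because `w i` lies in the span of
`w j` and the heavier vectors, and the latter are spanned by members of `B` other than `i`. -/
theorem IsMaxBase.exists_exchange [FiniteDimensional ℝ E] (ht : TiesOnly v i j)
    (hc : SpanCondition w {m | v i < v m} i j) (hB : IsMaxBase w v B) (hi : i ∈ B) : ∃ B', IsMaxBase w v B' ∧ j ∈ B' ∧ i ∉ B' := by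
  classical
  obtain ⟨hij, hv, ht'⟩ := ht
  obtain ⟨-, hj, hs⟩ := hc
  have hjB : j ∉ B := fun h => by
    refine hB.1.1.notMem_span h (?_ : w j ∈ _)
    rw [Set.image_insert_eq, span_insert, hB.span_image_lt, ← span_insert,
      ← Set.image_insert_eq] at hs
    refine span_mono (Set.image_mono ?_) hs
    rintro m (rfl | ⟨hm, hlt⟩)
    · exact ⟨hi, by simpa using hij⟩
    · exact ⟨hm, fun h => by simp at h; subst h; exact absurd hlt (by rw [hv]; exact lt_irrefl _)⟩
  have hBe : insert i ((B.erase i : Finset ι) : Set ι) = B := by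
    rw [← Finset.coe_insert, Finset.insert_erase hi]
  have hnot : w j ∉ span ℝ (w '' ((B.erase i : Finset ι) : Set ι)) := by
    intro hmem
    have hiz : w i ∈ span ℝ (w '' insert j {m | v i < v m}) := by
      rw [Set.image_insert_eq] at hs ⊢
      exact mem_span_insert_exchange hs hj
    refine hB.1.1.notMem_span hi (?_ : w i ∈ _)
    rw [← Finset.coe_singleton, ← Finset.coe_sdiff, Finset.sdiff_singleton_eq_erase]
    rw [Set.image_insert_eq, span_insert, hB.span_image_lt] at hiz
    refine (sup_le (c := span ℝ (w '' ((B.erase i : Finset ι) : Set ι))) ?_ ?_ :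
      _ ≤ _) hiz
    · rw [span_singleton_le_iff_mem]; exact hmem
    · refine span_mono (Set.image_mono ?_)
      rintro m ⟨hm, hlt⟩
      simp only [Finset.coe_erase, Set.mem_sdiff, Finset.mem_coe, Set.mem_singleton_iff]
      exact ⟨hm, fun h => by subst h; exact lt_irrefl _ hlt⟩
  have hje : j ∉ B.erase i := fun h => hjB (Finset.mem_of_mem_erase h)
  refine ⟨insert j (B.erase i), ⟨⟨?_, ?_⟩, fun C hC => (hB.2 C hC).trans (le_of_eq ?_)⟩, by simp,
    by simp [hij]⟩
  · rw [Finset.coe_insert]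
    exact (hB.1.1.mono (by simp)).insert hnot
  · rw [Finset.card_insert_of_notMem hje, Finset.card_erase_add_one hi, hB.1.2]
  · rw [Finset.sum_insert hje, ← Finset.add_sum_erase _ _ hi, hv]

theorem SpanCondition.symm {Z : Set ι} (h : SpanCondition w Z i j) : SpanCondition w Z j i := by
  refine ⟨h.2.1, h.1, ?_⟩
  have := h.2.2
  rw [Set.image_insert_eq] at this ⊢
  exact mem_span_insert_exchange this h.2.1

theorem exists_isMaxBase [Finite ι] (h : ∃ B, IsBase w B) (v : ι → ℝ) : ∃ B, IsMaxBase w v B := by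
  obtain ⟨B, hB, hm⟩ := Set.exists_max_image {B | IsBase w B} (fun B => ∑ f ∈ B, v f)
    (Set.toFinite _) h
  exact ⟨B, hB, hm⟩

theorem spanCondition_iff_exists_isMaxBase [FiniteDimensional ℝ E] [Finite ι] (h : ∃ B, IsBase w B)
    (ht : TiesOnly v i j) :
    SpanCondition w {m | v i < v m} i j ↔
      ∃ B B', IsMaxBase w v B ∧ IsMaxBase w v B' ∧ i ∈ B ∧ j ∉ B ∧ i ∉ B' ∧ j ∈ B' := by
  constructor
  · intro hc
    obtain ⟨B, hB⟩ := exists_isMaxBase h v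
    -- If `B` missed both, the greedy property would put `w i` in the span of members of `B` that
    -- are strictly heavier, as ties occur only between `i` and `j`.
    have hor : i ∈ B ∨ j ∈ B := by
      by_contra! hn
      refine hc.1 (span_mono (Set.image_mono ?_) (hB.mem_span i))
      rintro m ⟨hm, hle⟩
      refine lt_of_le_of_ne hle ?_
      have hmi : m ≠ i := fun h => hn.1 (h ▸ hm)
      have hmj : m ≠ j := fun h => hn.2 (h ▸ hm)
      exact ht.2.2 m hmi hmj i hmi.symm
    rcases hor with hi | hj
    · obtain ⟨B', hB', hj', hi'⟩ := hB.exists_exchange ht hc hi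
      have := hB.exchange ht hB' (fun h => hi' (h ▸ hi))
      exact ⟨B, B', hB, hB', by tauto⟩
    · have hc' := hc.symm
      rw [ht.2.1] at hc'
      obtain ⟨B', hB', hi', hj'⟩ := hB.exists_exchange ht.symm hc' hj
      have := hB.exchange ht hB' (fun h => hj' (h ▸ hj))
      exact ⟨B', B, hB', hB, by tauto⟩
  · rintro ⟨B, B', hB, hB', hi, hj, hi', hj'⟩
    refine ⟨hB.notMem_span hi, ht.2.1 ▸ hB'.notMem_span hj', ?_⟩
    refine span_mono (Set.image_mono ?_) (hB.mem_span j)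
    rintro m ⟨hm, hle⟩
    by_cases hmi : m = i
    · exact Or.inl hmi
    · refine Or.inr (lt_of_le_of_ne (ht.2.1 ▸ hle) ?_)
      exact ht.2.2 m hmi (fun h => hj (h ▸ hm)) i (Ne.symm hmi)

theorem finrank_span_image_insert_eq_iff [FiniteDimensional ℝ E] (w : ι → E) (Z : Set ι) (i : ι) :
    Module.finrank ℝ (span ℝ (w '' insert i Z)) = Module.finrank ℝ (span ℝ (w '' Z)) + 1 ↔
      w i ∉ span ℝ (w '' Z) := by
  constructor
  · intro h hi
    rw [Set.image_insert_eq, span_insert_eq_span hi] at h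
    omega
  · intro hi
    have h1 : span ℝ (w '' Z) < span ℝ (w '' insert i Z) := by
      refine lt_of_le_of_ne (span_mono (Set.image_mono (by simp))) fun he => hi ?_
      rw [he]; exact subset_span ⟨i, by simp, rfl⟩
    have h2 := finrank_lt_finrank_of_lt h1
    have h3 : Module.finrank ℝ (span ℝ (w '' insert i Z)) ≤
        Module.finrank ℝ (span ℝ (w '' Z)) + 1 := by
      rw [Set.image_insert_eq, span_insert, sup_comm]
      refine (finrank_add_le_finrank_add_finrank _ _).trans ?_
      have := (finrank_span_le_card (R := ℝ) {w i})
      simp only [Set.toFinset_singleton, Finset.card_singleton] at this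
      omega
    omega

end MaxBase

variable {N M : ℕ} {A : Matrix (Fin N) (Fin M) ℝ}

/-! ### Linear algebra of the columns of `A`: rank conditions, pivots and counting. -/

section Columns

open Submodule

theorem colRank_eq_finrank_span (A : Matrix (Fin N) (Fin M) ℝ) {Z : Finset (Fin M)}
    {S : Set (Fin M)} (h : (Z : Set (Fin M)) = S) :
    colRank A Z = Module.finrank ℝ (span ℝ (A.col '' S)) := by
  subst h
  rw [colRank, Matrix.rank_eq_finrank_span_cols, Set.image_eq_range]
  rfl

/-- The bound `r ≤ N - 1` is automatic: adding column `i` raises the rank, which cannot exceed `N`.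
-/
theorem rankCondition_iff (A : Matrix (Fin N) (Fin M) ℝ) (Z : Finset (Fin M)) (i j : Fin M) :
    RankCondition A Z i j ↔ SpanCondition A.col (Z : Set (Fin M)) i j := by
  rw [RankCondition, SpanCondition, colRank_eq_finrank_span A (Finset.coe_insert i Z),
    colRank_eq_finrank_span A (Finset.coe_insert j Z),
    colRank_eq_finrank_span A (Z := insert i (insert j Z))
      (S := insert i (insert j (Z : Set (Fin M)))) (by simp),
    colRank_eq_finrank_span A (Z := Z) rfl,
    finrank_span_image_insert_eq_iff, finrank_span_image_insert_eq_iff]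
  constructor
  · rintro ⟨-, hi, hj, hij⟩
    refine ⟨hi, hj, ?_⟩
    rw [← finrank_span_image_insert_eq_iff] at hi
    have hle : span ℝ (A.col '' insert i (Z : Set (Fin M))) ≤
        span ℝ (A.col '' insert i (insert j (Z : Set (Fin M)))) :=
      span_mono (Set.image_mono (Set.insert_subset_insert (Set.subset_insert _ _)))
    rw [Submodule.eq_of_le_of_finrank_eq hle (by rw [hi, hij])]
    exact subset_span ⟨j, by simp, rfl⟩
  · rintro ⟨hi, hj, hij⟩
    have hi' := (finrank_span_image_insert_eq_iff A.col _ i).2 hi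
    refine ⟨?_, hi, hj, ?_⟩
    · rw [← hi']
      exact (Submodule.finrank_le _).trans (by simp)
    · rw [Set.insert_comm, Set.image_insert_eq, span_insert_eq_span hij, hi']

theorem IsPivot.unique {n : Fin N} {e e' : Fin M} (h : IsPivot A n e) (h' : IsPivot A n e') :
    e = e' := by
  rcases lt_trichotomy e e' with hlt | heq | hlt
  · exact absurd (h'.2 e hlt) h.1
  · exact heq
  · exact absurd (h.2 e' hlt) h'.1

theorem IsIrreducible.exists_pivot (hirr : IsIrreducible A) (hrref : IsRREF A) :
    ∃ e : Fin N ↪o Fin M, ∀ n, IsPivot A n (e n) := by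
  choose e m he _ using hirr.row
  exact ⟨OrderEmbedding.ofStrictMono e fun n n' h => hrref.pivot_lt n n' _ _ h (he n) (he n'), he⟩

theorem IsRREF.apply_pivot (hrref : IsRREF A) {e : Fin N → Fin M}
    (he : ∀ n, IsPivot A n (e n)) (n n' : Fin N) : A n' (e n) = if n' = n then 1 else 0 := by
  split_ifs with h
  · subst h; exact hrref.pivot_eq_one _ _ (he _)
  · exact hrref.pivot_column _ _ (he n) _ h

theorem IsRREF.col_pivot (hrref : IsRREF A) {e : Fin N → Fin M}
    (he : ∀ n, IsPivot A n (e n)) (n : Fin N) : A.col (e n) = Pi.single n 1 := by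
  ext n'
  rw [Matrix.col_apply, hrref.apply_pivot he, Pi.single_apply]

theorem minor_pivot (hrref : IsRREF A) {e : Fin N ↪o Fin M} (he : ∀ n, IsPivot A n (e n)) :
    minor A e = 1 := by
  have : A.submatrix id e = 1 := by
    ext n n'
    rw [Matrix.submatrix_apply, id, hrref.apply_pivot he, Matrix.one_apply]
  rw [minor, this, Matrix.det_one]

theorem isPivotColumn_iff_exists {e : Fin N → Fin M} (he : ∀ n, IsPivot A n (e n)) (m : Fin M) :
    IsPivotColumn A m ↔ m ∈ Set.range e := by
  constructor
  · rintro ⟨n, hn⟩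
    exact ⟨n, (he n).unique hn⟩
  · rintro ⟨n, rfl⟩
    exact ⟨n, he n⟩

theorem col_mem_span_of_forall (hrref : IsRREF A) {e : Fin N → Fin M}
    (he : ∀ n, IsPivot A n (e n)) {m : Fin M} {Z : Set (Fin M)}
    (h : ∀ n, A n m ≠ 0 → e n ∈ Z) : A.col m ∈ span ℝ (A.col '' Z) := by
  have : A.col m = ∑ n, A n m • A.col (e n) := by
    ext n'
    simp [hrref.col_pivot he, Pi.single_apply]
  rw [this]
  refine sum_mem fun n _ => ?_
  by_cases h0 : A n m = 0
  · simp [h0]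
  · exact smul_mem _ _ (subset_span ⟨e n, h n h0, rfl⟩)

theorem col_notMem_span_of_row {n : Fin N} {m : Fin M} {Z : Set (Fin M)} (hm : A n m ≠ 0)
    (hZ : ∀ z ∈ Z, A n z = 0) : A.col m ∉ span ℝ (A.col '' Z) := by
  have hle : span ℝ (A.col '' Z) ≤ LinearMap.ker (LinearMap.proj (R := ℝ) (φ := fun _ => ℝ) n) := by
    rw [span_le]
    rintro _ ⟨z, hz, rfl⟩
    simpa using hZ z hz
  exact fun h => hm (by simpa using hle h)

theorem isPivotColumn_iff_notMem_span (hrref : IsRREF A) (hirr : IsIrreducible A) (m : Fin M) :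
    IsPivotColumn A m ↔ A.col m ∉ span ℝ (A.col '' Set.Iio m) := by
  obtain ⟨e, he⟩ := hirr.exists_pivot hrref
  constructor
  · rintro ⟨n, hn⟩
    exact col_notMem_span_of_row hn.1 hn.2
  · contrapose!
    intro hm
    refine col_mem_span_of_forall hrref he fun n hn => ?_
    have h1 : e n ≤ m := not_lt.1 fun h => hn ((he n).2 m h)
    exact lt_of_le_of_ne h1 fun h => hm ⟨n, h ▸ he n⟩

/-- No column is indispensable. A non-pivot column is a combination of pivot columns; for the pivot
of row `n`, a second nonzero entry of that row gives a column whose expansion involves the pivot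
column and can be solved for it. -/
theorem col_mem_span_of_ne (hrref : IsRREF A) (hirr : IsIrreducible A) (m : Fin M) :
    A.col m ∈ span ℝ (A.col '' {m}ᶜ) := by
  obtain ⟨e, he⟩ := hirr.exists_pivot hrref
  by_cases hm : m ∈ Set.range e
  · obtain ⟨n, rfl⟩ := hm
    obtain ⟨e', m, he', hne, h0⟩ := hirr.row n
    obtain rfl := he'.unique (he n)
    have hme : A.col m ∈ span ℝ (A.col '' insert (e n) {e n}ᶜ) :=
      subset_span ⟨m, by simp [hne], rfl⟩
    by_contra hcon
    have hsub : A.col m ∈ span ℝ (A.col '' insert (e n) (Set.range e \ {e n})) := by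
      refine col_mem_span_of_forall hrref he fun n' _ => ?_
      by_cases h : e n' = e n
      · simp [h]
      · exact Or.inr ⟨⟨n', rfl⟩, h⟩
    have hnot : A.col m ∉ span ℝ (A.col '' (Set.range e \ {e n})) := by
      refine col_notMem_span_of_row h0 ?_
      rintro _ ⟨⟨n', rfl⟩, hne'⟩
      rw [hrref.apply_pivot he, if_neg]
      rintro rfl
      exact hne' rfl
    rw [Set.image_insert_eq] at hsub
    have := mem_span_insert_exchange hsub hnot
    rw [← Set.image_insert_eq] at this
    refine hcon (span_mono (Set.image_mono ?_) this)
    rintro x (rfl | hx)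
    · exact hne
    · exact hx.2
  · refine col_mem_span_of_forall hrref he fun n _ => ?_
    rintro h
    exact hm ⟨n, h⟩

theorem coe_outerColumns (i j : Fin M) :
    (outerColumns i j : Set (Fin M)) = Set.Iio i ∪ Set.Ioi j := by
  simp [outerColumns]

theorem coe_innerColumns (i j : Fin M) : (innerColumns i j : Set (Fin M)) = Set.Ioo i j := by
  simp [innerColumns]

theorem isPivotColumn_of_rankCondition_outer (hrref : IsRREF A) (hirr : IsIrreducible A)
    {i j : Fin M} (h : RankCondition A (outerColumns i j) i j) : IsPivotColumn A i := by
  rw [rankCondition_iff, coe_outerColumns] at h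
  rw [isPivotColumn_iff_notMem_span hrref hirr]
  exact fun hm => h.1 (span_mono (Set.image_mono Set.subset_union_left) hm)

theorem not_isPivotColumn_of_rankCondition_inner (hrref : IsRREF A) (hirr : IsIrreducible A)
    {i j : Fin M} (hij : i < j) (h : RankCondition A (innerColumns i j) i j) :
    ¬ IsPivotColumn A j := by
  rw [rankCondition_iff, coe_innerColumns] at h
  rw [isPivotColumn_iff_notMem_span hrref hirr, not_not]
  refine span_mono (Set.image_mono ?_) h.2.2
  rintro x (rfl | hx)
  · exact hij
  · exact hx.2

/-- As `j` decreases towards `e`, the columns before `e` together with those from `j` on form a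
growing family. Column `e` is outside the span of the columns before it and inside the span of all
other columns, so it enters at exactly one `j`, the maximum of `D`. -/
theorem existsUnique_rankCondition_outer (hrref : IsRREF A) (hirr : IsIrreducible A)
    {e : Fin M} (he : IsPivotColumn A e) :
    ∃! j, e < j ∧ RankCondition A (outerColumns e j) e j := by
  classical
  rw [isPivotColumn_iff_notMem_span hrref hirr] at he
  simp only [rankCondition_iff, coe_outerColumns]
  set D : Set (Fin M) := {j | e < j ∧
    A.col e ∈ span ℝ (A.col '' insert j (Set.Iio e ∪ Set.Ioi j))} with hD
  -- The successor of `e` belongs to `D`, since the family is then every column but `e`.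
  have hDne : D.Nonempty := by
    have hne : (Set.Ioi e).Nonempty := by
      by_contra h
      rw [Set.not_nonempty_iff_eq_empty] at h
      refine he ?_
      have := col_mem_span_of_ne hrref hirr e
      rwa [← Set.Iio_union_Ioi, h, Set.union_empty] at this
    obtain ⟨j, hj, hmin⟩ := Set.exists_min_image (Set.Ioi e) id (Set.toFinite _) hne
    refine ⟨j, hj, span_mono (Set.image_mono ?_) (col_mem_span_of_ne hrref hirr e)⟩
    intro x hx
    rcases lt_or_gt_of_ne (show x ≠ e from hx) with h | h
    · exact Or.inr (Or.inl h)
    · rcases (hmin x h : j ≤ x).eq_or_lt with h' | h'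
      · exact Or.inl h'.symm
      · exact Or.inr (Or.inr h')
  obtain ⟨j, ⟨hej, hj⟩, hmax⟩ := Set.exists_max_image D id (Set.toFinite _) hDne
  -- Otherwise the successor of `j` would lie in `D`, or, if `j` is last, `e` would not be a pivot.
  have hnot : A.col e ∉ span ℝ (A.col '' (Set.Iio e ∪ Set.Ioi j)) := by
    intro hmem
    by_cases hne : (Set.Ioi j).Nonempty
    · obtain ⟨l, hl, hmin⟩ := Set.exists_min_image (Set.Ioi j) id (Set.toFinite _) hne
      refine absurd (hmax l ⟨hej.trans hl, span_mono (Set.image_mono ?_) hmem⟩) (not_le.2 hl)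
      rintro x (h | h)
      · exact Or.inr (Or.inl h)
      · rcases (hmin x h : l ≤ x).eq_or_lt with h' | h'
        · exact Or.inl h'.symm
        · exact Or.inr (Or.inr h')
    · rw [Set.not_nonempty_iff_eq_empty] at hne
      rw [hne, Set.union_empty] at hmem
      exact he hmem
  have hjs : A.col j ∈ span ℝ (A.col '' insert e (Set.Iio e ∪ Set.Ioi j)) := by
    rw [Set.image_insert_eq] at hj ⊢
    exact mem_span_insert_exchange hj hnot
  refine ⟨j, ⟨hej, hnot, fun h => hnot ?_, hjs⟩, ?_⟩
  · rw [Set.image_insert_eq, span_insert_eq_span h] at hj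
    exact hj
  · rintro l ⟨hel, hl⟩
    rcases lt_trichotomy l j with hlt | heq | hlt
    · refine absurd (span_mono (Set.image_mono ?_) hj) hl.1
      rintro x (rfl | h | h)
      · exact Or.inr hlt
      · exact Or.inl h
      · exact Or.inr (hlt.trans h)
    · exact heq
    · refine absurd (hmax l ⟨hel, hl.symm.2.2⟩) (not_le.2 hlt)

/-- The mirror argument: as `i` decreases, the columns from `i` to just before `g` grow from none,
whose span misses the nonzero column `g`, to all columns before `g`, whose span contains it because
`g` is not a pivot. -/
theorem existsUnique_rankCondition_inner (hrref : IsRREF A) (hirr : IsIrreducible A)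
    {g : Fin M} (hg : ¬ IsPivotColumn A g) :
    ∃! i, i < g ∧ RankCondition A (innerColumns i g) i g := by
  rw [isPivotColumn_iff_notMem_span hrref hirr, not_not] at hg
  simp only [rankCondition_iff, coe_innerColumns]
  have h0 : A.col g ≠ 0 := by
    obtain ⟨n, hn⟩ := hirr.column g
    exact fun h => hn (congrFun h n)
  set D : Set (Fin M) := {i | i < g ∧ A.col g ∈ span ℝ (A.col '' insert i (Set.Ioo i g))} with hD
  have hDne : D.Nonempty := by
    have hne : (Set.Iio g).Nonempty := by
      by_contra h
      rw [Set.not_nonempty_iff_eq_empty] at h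
      rw [h] at hg
      exact h0 (by simpa using hg)
    obtain ⟨i, hi, hmin⟩ := Set.exists_min_image (Set.Iio g) id (Set.toFinite _) hne
    refine ⟨i, hi, span_mono (Set.image_mono fun x hx => ?_) hg⟩
    rcases (hmin x hx : i ≤ x).eq_or_lt with h' | h'
    · exact Or.inl h'.symm
    · exact Or.inr ⟨h', hx⟩
  obtain ⟨i, ⟨hig, hi⟩, hmax⟩ := Set.exists_max_image D id (Set.toFinite _) hDne
  have hnot : A.col g ∉ span ℝ (A.col '' Set.Ioo i g) := by
    intro hmem
    by_cases hne : (Set.Ioo i g).Nonempty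
    · obtain ⟨l, hl, hmin⟩ := Set.exists_min_image (Set.Ioo i g) id (Set.toFinite _) hne
      refine absurd (hmax l ⟨hl.2, span_mono (Set.image_mono fun x hx => ?_) hmem⟩) (not_le.2 hl.1)
      rcases (hmin x hx : l ≤ x).eq_or_lt with h' | h'
      · exact Or.inl h'.symm
      · exact Or.inr ⟨h', hx.2⟩
    · rw [Set.not_nonempty_iff_eq_empty] at hne
      rw [hne] at hmem
      exact h0 (by simpa using hmem)
  refine ⟨i, ⟨hig, fun h => hnot ?_, hnot, hi⟩, ?_⟩
  · rw [Set.image_insert_eq, span_insert_eq_span h] at hi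
    exact hi
  · rintro l ⟨hlg, hl⟩
    rcases lt_trichotomy l i with hlt | heq | hlt
    · refine absurd (span_mono (Set.image_mono ?_) hi) hl.2.1
      rintro x (rfl | h)
      · exact ⟨hlt, hig⟩
      · exact ⟨hlt.trans h.1, h.2⟩
    · exact heq
    · exact absurd (hmax l ⟨hlg, hl.2.2⟩) (not_le.2 hlt)

theorem encard_isPivotColumn (hrref : IsRREF A) (hirr : IsIrreducible A) :
    {e | IsPivotColumn A e}.encard = N := by
  obtain ⟨e, he⟩ := hirr.exists_pivot hrref
  have : {m | IsPivotColumn A m} = Set.range e := Set.ext fun m => isPivotColumn_iff_exists he m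
  rw [this, ← Set.image_univ, e.injective.encard_image, Set.encard_univ]
  simp

theorem encard_not_isPivotColumn (hrref : IsRREF A) (hirr : IsIrreducible A) :
    {g | ¬ IsPivotColumn A g}.encard = (M - N : ℕ) := by
  have h1 := encard_isPivotColumn hrref hirr
  have h2 := Set.encard_add_encard_compl {e | IsPivotColumn A e}
  rw [h1, Set.encard_univ, Set.compl_ofPred] at h2
  have hfin : {g | ¬ IsPivotColumn A g}.encard ≠ ⊤ := (Set.toFinite _).encard_lt_top.ne
  obtain ⟨c, hc⟩ := ENat.ne_top_iff_exists.1 hfin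
  rw [← hc] at h2 ⊢
  simp only [ENat.card_eq_coe_fintype_card, Fintype.card_fin] at h2
  norm_cast at h2 ⊢
  omega

theorem encard_setOf_prod_eq_fst {α β : Type*} {P : α → Prop} {Q : α → β → Prop}
    (h1 : ∀ a b, Q a b → P a) (h2 : ∀ a, P a → ∃! b, Q a b) :
    {ab : α × β | Q ab.1 ab.2}.encard = {a | P a}.encard := by
  have hinj : Set.InjOn Prod.fst {ab : α × β | Q ab.1 ab.2} := by
    rintro ⟨a, b⟩ h ⟨a', b'⟩ h' (rfl : a = a')
    exact Prod.ext rfl ((h2 a (h1 a b h)).unique h h')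
  rw [← hinj.encard_image]
  congr 1
  ext a
  constructor
  · rintro ⟨⟨a, b⟩, h, rfl⟩
    exact h1 a b h
  · intro ha
    obtain ⟨b, hb, -⟩ := h2 a ha
    exact ⟨(a, b), hb, rfl⟩

theorem encard_setOf_prod_eq_snd {α β : Type*} {P : β → Prop} {Q : α → β → Prop}
    (h1 : ∀ a b, Q a b → P b) (h2 : ∀ b, P b → ∃! a, Q a b) :
    {ab : α × β | Q ab.1 ab.2}.encard = {b | P b}.encard := by
  rw [← encard_setOf_prod_eq_fst (Q := fun b a => Q a b) (fun b a => h1 a b) h2,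
    ← Prod.swap_injective.encard_image]
  congr 1
  ext ⟨b, a⟩
  simp

end Columns

/-! ### Positivity of `τ`, and `u` as a variance. -/

variable {k θ₀ : Fin M → ℝ}

theorem minor_ne_zero_iff (A : Matrix (Fin N) (Fin M) ℝ) (m : Fin N ↪o Fin M) :
    minor A m ≠ 0 ↔ IsBase A.col (Finset.univ.map m.toEmbedding) := by
  rw [minor, ← isUnit_iff_ne_zero, ← Matrix.isUnit_iff_isUnit_det,
    ← Matrix.linearIndependent_cols_iff_isUnit, IsBase]
  simp only [Finset.coe_map, Finset.coe_univ, Set.image_univ, Finset.card_map, Finset.card_univ,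
    Fintype.card_fin, Module.finrank_fintype_fun_eq_card, and_true]
  exact (linearIndepOn_range_iff m.injective A.col).symm

theorem tauTerm_nonneg (hpos : IsPositive A k) (m : Fin N ↪o Fin M) (x y t : ℝ) :
    0 ≤ tauTerm A k θ₀ m x y t := by
  have h : 0 ≤ minor A m := by
    by_contra! h
    exact (hpos.minor_pos m h.ne).not_gt h
  refine mul_nonneg (mul_nonneg h (Real.exp_pos _).le) ?_
  exact Finset.prod_nonneg fun s _ => Finset.prod_nonneg fun r hr =>
    sub_nonneg.2 (hpos.strictMono (m.strictMono (Finset.mem_Ioi.1 hr))).le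

theorem tauTerm_pos (hpos : IsPositive A k) {m : Fin N ↪o Fin M} (hm : minor A m ≠ 0)
    (x y t : ℝ) : 0 < tauTerm A k θ₀ m x y t :=
  mul_pos (mul_pos (hpos.minor_pos m hm) (Real.exp_pos _)) <|
    Finset.prod_pos fun _ _ => Finset.prod_pos fun _ hr =>
      sub_pos.2 (hpos.strictMono (m.strictMono (Finset.mem_Ioi.1 hr)))

theorem tau_pos (hpos : IsPositive A k) (hb : ∃ m : Fin N ↪o Fin M, minor A m ≠ 0)
    (x y t : ℝ) : 0 < tau A k θ₀ x y t := by
  obtain ⟨m, hm⟩ := hb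
  exact Finset.sum_pos' (fun m _ => tauTerm_nonneg hpos m x y t)
    ⟨m, Finset.mem_univ _, tauTerm_pos hpos hm x y t⟩

theorem tauTerm_le_tau (hpos : IsPositive A k) (m : Fin N ↪o Fin M) (x y t : ℝ) :
    tauTerm A k θ₀ m x y t ≤ tau A k θ₀ x y t :=
  Finset.single_le_sum (f := fun m => tauTerm A k θ₀ m x y t)
    (fun m _ => tauTerm_nonneg hpos m x y t) (Finset.mem_univ m)

theorem hasDerivAt_tauTerm (A : Matrix (Fin N) (Fin M) ℝ) (k θ₀ : Fin M → ℝ)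
    (m : Fin N ↪o Fin M) (x y t : ℝ) :
    HasDerivAt (fun x' => tauTerm A k θ₀ m x' y t)
      ((∑ n, k (m n)) * tauTerm A k θ₀ m x y t) x := by
  have h : HasDerivAt (fun x' => ∑ n, phase k θ₀ (m n) x' y t) (∑ n, k (m n)) x := by
    refine HasDerivAt.fun_sum fun n _ => ?_
    unfold phase
    simpa using (((((hasDerivAt_id x).const_mul (k (m n))).add_const
      (k (m n) ^ 2 * y)).add_const (k (m n) ^ 3 * t)).add_const (θ₀ (m n)))
  refine ((h.exp.const_mul (minor A m)).mul_const
    (∏ s : Fin N, ∏ r ∈ Finset.Ioi s, (k (m r) - k (m s)))).congr_deriv ?_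
  unfold tauTerm
  ring

/-- The solution is twice the variance of `∑ n, k (m n)`, where `m` has the weights
`tauTerm A k θ₀ m / tau A k θ₀`. -/
theorem solution_eq (hpos : IsPositive A k) (hb : ∃ m : Fin N ↪o Fin M, minor A m ≠ 0)
    (x y t : ℝ) :
    solution A k θ₀ x y t = ∑ m : Fin N ↪o Fin M, ∑ l : Fin N ↪o Fin M,
      (∑ n, k (m n) - ∑ n, k (l n)) ^ 2 *
        ((tauTerm A k θ₀ m x y t / tau A k θ₀ x y t) *
          (tauTerm A k θ₀ l x y t / tau A k θ₀ x y t)) := by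
  set K : (Fin N ↪o Fin M) → ℝ := fun m => ∑ n, k (m n) with hK
  have h0 : ∀ x', HasDerivAt (fun x' => tau A k θ₀ x' y t)
      (∑ m, K m * tauTerm A k θ₀ m x' y t) x' := fun x' =>
    HasDerivAt.fun_sum fun m _ => hasDerivAt_tauTerm A k θ₀ m x' y t
  have h1 : HasDerivAt (fun x' => ∑ m, K m * tauTerm A k θ₀ m x' y t)
      (∑ m, K m * (K m * tauTerm A k θ₀ m x y t)) x :=
    HasDerivAt.fun_sum fun m _ => (hasDerivAt_tauTerm A k θ₀ m x y t).const_mul (K m)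
  have hne : ∀ x', tau A k θ₀ x' y t ≠ 0 := fun x' => (tau_pos hpos hb x' y t).ne'
  have hd : deriv (fun x' => Real.log (tau A k θ₀ x' y t)) =
      fun x' => (∑ m, K m * tauTerm A k θ₀ m x' y t) / tau A k θ₀ x' y t :=
    funext fun x' => ((h0 x').log (hne x')).deriv
  rw [solution, iteratedDeriv_succ, iteratedDeriv_one, hd, (h1.fun_div (h0 x) (hne x)).deriv]
  have hs : ∀ m l, (K m - K l) ^ 2 * ((tauTerm A k θ₀ m x y t / tau A k θ₀ x y t) *
      (tauTerm A k θ₀ l x y t / tau A k θ₀ x y t)) =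
      (tau A k θ₀ x y t ^ 2)⁻¹ *
      ((K m * (K m * tauTerm A k θ₀ m x y t)) * tauTerm A k θ₀ l x y t +
        tauTerm A k θ₀ m x y t * (K l * (K l * tauTerm A k θ₀ l x y t)) -
        2 * ((K m * tauTerm A k θ₀ m x y t) * (K l * tauTerm A k θ₀ l x y t))) := by
    intro m l
    have := hne x
    field_simp
    ring
  refine Eq.trans ?_ (Finset.sum_congr rfl fun m _ => Finset.sum_congr rfl fun l _ => (hs m l).symm)
  simp only [← Finset.mul_sum, Finset.sum_sub_distrib, Finset.sum_add_distrib,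
    ← Finset.sum_mul]
  change _ = _ * (_ * tau A k θ₀ x y t + tau A k θ₀ x y t * _ - _)
  have := hne x
  field_simp
  ring

/-! ### Strips, and comparison of terms along a line. -/

/-- The points of the strip of half-width `c` around the line `x + s y = 0`. -/
def lineStrip (F : Filter ℝ) (s c : ℝ) : Filter (ℝ × ℝ) :=
  strip F (fun x y => x + s * y) c

/-- The offset `b`, which carries the time dependence and the constants, is absorbed by widening the
strip; so one normal form of strip serves all `t` and `R`. -/
theorem strip_le_lineStrip {F : Filter ℝ} {ϑ : ℝ → ℝ → ℝ} {a s b : ℝ} (ha : a ≠ 0)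
    (h : ∀ x y, ϑ x y = a * (x + s * y) + b) (R : ℝ) :
    strip F ϑ R ≤ lineStrip F s ((R + |b|) / |a|) := by
  refine inf_le_inf_left _ (principal_mono.2 fun z hz => ?_)
  simp only [Set.mem_ofPred_eq, h] at hz ⊢
  rw [le_div_iff₀ (abs_pos.2 ha), ← abs_mul, mul_comm]
  have := abs_sub (a * (z.1 + s * z.2) + b) b
  rw [add_sub_cancel_right] at this
  linarith

theorem tendsto_curve_strip {F : Filter ℝ} {ϑ : ℝ → ℝ → ℝ} {s ξ R : ℝ}
    (h : ∀ y, |ϑ (-s * y + ξ) y| ≤ R) :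
    Tendsto (fun y => (-s * y + ξ, y)) F (strip F ϑ R) := by
  refine tendsto_inf.2 ⟨tendsto_comap_iff.2 tendsto_id, tendsto_principal.2 (.of_forall h)⟩

/-- The total phase is `K (x + s y) + W (σ y) + G`; in the strip the first summand is bounded, so
the weights `W` decide. -/
theorem tauTerm_div_tendsto {F : Filter ℝ} {σ s : ℝ} (hσ : σ * σ = 1)
    (hF : Tendsto (fun y => σ * y) F atTop) {m l : Fin N ↪o Fin M}
    (hlt : ∑ n, σ * (k (m n) ^ 2 - s * k (m n)) < ∑ n, σ * (k (l n) ^ 2 - s * k (l n)))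
    (t c : ℝ) :
    Tendsto (fun z : ℝ × ℝ => tauTerm A k θ₀ m z.1 z.2 t / tauTerm A k θ₀ l z.1 z.2 t)
      (lineStrip F s c) (𝓝 0) := by
  set K : (Fin N ↪o Fin M) → ℝ := fun m => ∑ n, k (m n) with hK
  set Wt : (Fin N ↪o Fin M) → ℝ := fun m => ∑ n, σ * (k (m n) ^ 2 - s * k (m n)) with hWt
  set G : (Fin N ↪o Fin M) → ℝ := fun m => ∑ n, (k (m n) ^ 3 * t + θ₀ (m n)) with hG
  have hphase : ∀ (m : Fin N ↪o Fin M) (x y : ℝ), ∑ n, phase k θ₀ (m n) x y t =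
      K m * (x + s * y) + Wt m * (σ * y) + G m := by
    intro m x y
    simp only [hK, hWt, hG, Finset.sum_mul, ← Finset.sum_add_distrib]
    refine Finset.sum_congr rfl fun n _ => ?_
    unfold phase
    linear_combination (-(k (m n) ^ 2 - s * k (m n)) * y) * hσ
  set C : ℝ := minor A m * (∏ s : Fin N, ∏ r ∈ Finset.Ioi s, (k (m r) - k (m s))) /
    (minor A l * (∏ s : Fin N, ∏ r ∈ Finset.Ioi s, (k (l r) - k (l s)))) with hC
  have heq : ∀ z : ℝ × ℝ, tauTerm A k θ₀ m z.1 z.2 t / tauTerm A k θ₀ l z.1 z.2 t =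
      C * Real.exp ((Wt m - Wt l) * (σ * z.2) +
        ((K m - K l) * (z.1 + s * z.2) + (G m - G l))) := by
    intro z
    have : (Wt m - Wt l) * (σ * z.2) + ((K m - K l) * (z.1 + s * z.2) + (G m - G l)) =
        ∑ n, phase k θ₀ (m n) z.1 z.2 t - ∑ n, phase k θ₀ (l n) z.1 z.2 t := by
      rw [hphase, hphase]; ring
    rw [this, Real.exp_sub, tauTerm, tauTerm, hC]
    ring
  simp only [heq]
  rw [← mul_zero C]
  refine (Real.tendsto_exp_atBot.comp ?_).const_mul C
  have hy : Tendsto (fun z : ℝ × ℝ => (Wt m - Wt l) * (σ * z.2)) (lineStrip F s c) atBot :=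
    (hF.comp (tendsto_comap.mono_left inf_le_left)).const_mul_atTop_of_neg (sub_neg.2 hlt)
  refine tendsto_atBot_add_right_of_ge' _ (|K m - K l| * c + |G m - G l|) hy ?_
  filter_upwards [mem_inf_of_right (mem_principal_self _)] with z hz
  refine (le_abs_self _).trans ((abs_add_le _ _).trans ?_)
  rw [abs_mul]
  gcongr

/-- The weight of the index `m`, which governs the growth of `θ_m` along the line
`x + s y = 0`, as `σ y → ∞`. -/
def lineWeight (k : Fin M → ℝ) (σ s : ℝ) (m : Fin M) : ℝ := σ * (k m ^ 2 - s * k m)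

/-! ### Limits of a variance when one or two probabilities dominate. -/

section Asymptotics

variable {α ι : Type*} [Fintype ι] {L : Filter α} {p : ι → α → ℝ} {K : ι → ℝ}

theorem tendsto_variance_of_forall_ne (hp0 : ∀ m z, 0 ≤ p m z) (hp1 : ∀ m z, p m z ≤ 1)
    {a : ι} (h : ∀ m, m ≠ a → Tendsto (p m) L (𝓝 0)) :
    Tendsto (fun z => ∑ m, ∑ l, (K m - K l) ^ 2 * (p m z * p l z)) L (𝓝 0) := by
  rw [show (0 : ℝ) = ∑ m : ι, ∑ l : ι, 0 by simp]
  refine tendsto_finsetSum _ fun m _ => tendsto_finsetSum _ fun l _ => ?_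
  by_cases hml : m = l
  · subst hml; simpa using tendsto_const_nhds
  · rw [← mul_zero ((K m - K l) ^ 2)]
    refine Tendsto.const_mul _ ?_
    by_cases hm : m = a
    · refine squeeze_zero (fun z => mul_nonneg (hp0 _ _) (hp0 _ _)) (fun z => ?_)
        (h l (fun h => hml (hm.trans h.symm)))
      exact mul_le_of_le_one_left (hp0 _ _) (hp1 _ _)
    · refine squeeze_zero (fun z => mul_nonneg (hp0 _ _) (hp0 _ _)) (fun z => ?_) (h m hm)
      exact mul_le_of_le_one_right (hp0 _ _) (hp1 _ _)

theorem tendsto_variance_sub_of_forall_ne (hp0 : ∀ m z, 0 ≤ p m z) (hp1 : ∀ m z, p m z ≤ 1)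
    {a b : ι} (hab : a ≠ b) (h : ∀ m, m ≠ a → m ≠ b → Tendsto (p m) L (𝓝 0)) :
    Tendsto (fun z => ∑ m, ∑ l, (K m - K l) ^ 2 * (p m z * p l z) -
      2 * (K a - K b) ^ 2 * (p a z * p b z)) L (𝓝 0) := by
  classical
  -- The subtracted quantity is exactly the summands at `(a, b)` and `(b, a)`, hence the factor 2.
  -- The remaining summands vanish on the diagonal or involve an index outside `{a, b}`.
  have heq : ∀ z, ∑ m, ∑ l, (K m - K l) ^ 2 * (p m z * p l z) -
      2 * (K a - K b) ^ 2 * (p a z * p b z) =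
      ∑ m, ∑ l, ((K m - K l) ^ 2 * (p m z * p l z) -
        ((if m = a then (if l = b then (K a - K b) ^ 2 * (p a z * p b z) else 0) else 0) +
        (if m = b then (if l = a then (K a - K b) ^ 2 * (p a z * p b z) else 0) else 0))) := by
    intro z
    simp only [Finset.sum_sub_distrib, Finset.sum_add_distrib]
    simp
    ring
  simp only [heq]
  rw [show (0 : ℝ) = ∑ m : ι, ∑ l : ι, 0 by simp]
  refine tendsto_finsetSum _ fun m _ => tendsto_finsetSum _ fun l _ => ?_
  have hsmall : (m ≠ a ∧ m ≠ b) ∨ (l ≠ a ∧ l ≠ b) →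
      Tendsto (fun z => (K m - K l) ^ 2 * (p m z * p l z)) L (𝓝 0) := by
    intro hml
    rw [← mul_zero ((K m - K l) ^ 2)]
    refine Tendsto.const_mul _ ?_
    rcases hml with hm | hl
    · refine squeeze_zero (fun z => mul_nonneg (hp0 _ _) (hp0 _ _)) (fun z => ?_) (h m hm.1 hm.2)
      exact mul_le_of_le_one_right (hp0 _ _) (hp1 _ _)
    · refine squeeze_zero (fun z => mul_nonneg (hp0 _ _) (hp0 _ _)) (fun z => ?_) (h l hl.1 hl.2)
      exact mul_le_of_le_one_left (hp0 _ _) (hp1 _ _)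
  by_cases hma : m = a
  · subst hma
    by_cases hlb : l = b
    · subst hlb; simpa [hab] using tendsto_const_nhds
    · by_cases hlm : l = m
      · subst hlm; simpa [hab] using tendsto_const_nhds
      · simpa [hab, hlb] using hsmall (Or.inr ⟨hlm, hlb⟩)
  · by_cases hmb : m = b
    · subst hmb
      by_cases hla : l = a
      · subst hla
        refine tendsto_const_nhds.congr fun z => ?_
        simp [hab.symm]
        ring
      · by_cases hlm : l = m
        · subst hlm; simpa [hab.symm] using tendsto_const_nhds
        · simpa [hab.symm, hla] using hsmall (Or.inr ⟨hla, hlm⟩)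
    · simpa [hma, hmb] using hsmall (Or.inl ⟨hma, hmb⟩)

end Asymptotics

/-! ### Asymptotics of `τ` and `u` with one or two dominant terms. -/

theorem map_orderEmbedding_injective {m l : Fin N ↪o Fin M}
    (h : Finset.univ.map m.toEmbedding = Finset.univ.map l.toEmbedding) : m = l := by
  have h' : Set.range m = Set.range l := by
    simpa using congrArg (fun B : Finset (Fin M) => (B : Set (Fin M))) h
  exact DFunLike.coe_injective ((m.strictMono.range_inj l.strictMono).1 h')

theorem IsBase.exists_orderEmbedding {B : Finset (Fin M)} (hB : IsBase A.col B) :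
    ∃ m : Fin N ↪o Fin M, Finset.univ.map m.toEmbedding = B :=
  ⟨B.orderEmbOfFin (by simpa using hB.2), B.map_orderEmbOfFin_univ _⟩

theorem IsMaxBase.exists_eq_insert {ι E : Type*} [AddCommGroup E] [Module ℝ E]
    [FiniteDimensional ℝ E] [DecidableEq ι] {w : ι → E} {v : ι → ℝ} {i j : ι} {B B' : Finset ι}
    (ht : TiesOnly v i j) (hB : IsMaxBase w v B) (hB' : IsMaxBase w v B')
    (hi : i ∈ B) (hj : j ∉ B) (hi' : i ∉ B') (hj' : j ∈ B') :
    ∃ S : Finset ι, i ∉ S ∧ j ∉ S ∧ B = insert i S ∧ B' = insert j S := by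
  have h := hB.sdiff_eq ht hB'
  have hmem : ∀ f, f ≠ i → f ≠ j → (f ∈ B ↔ f ∈ B') := fun f h1 h2 => by
    simpa [h1, h2] using Set.ext_iff.1 h f
  refine ⟨B.erase i, by simp, fun h => hj (Finset.mem_of_mem_erase h),
    (Finset.insert_erase hi).symm, ?_⟩
  ext f
  by_cases h1 : f = i
  · subst h1; simp [hi', ht.1]
  · by_cases h2 : f = j
    · subst h2; simp [hj']
    · simp [h1, h2, hmem f h1 h2]

theorem tauTerm_div_tendsto_of_isMaxBase {F : Filter ℝ} {σ s : ℝ} (hσ : σ * σ = 1)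
    (hF : Tendsto (fun y => σ * y) F atTop) {a m : Fin N ↪o Fin M}
    (ha : IsMaxBase A.col (lineWeight k σ s) (Finset.univ.map a.toEmbedding))
    (hm : ¬ IsMaxBase A.col (lineWeight k σ s) (Finset.univ.map m.toEmbedding)) (t c : ℝ) :
    Tendsto (fun z : ℝ × ℝ => tauTerm A k θ₀ m z.1 z.2 t / tauTerm A k θ₀ a z.1 z.2 t)
      (lineStrip F s c) (𝓝 0) := by
  by_cases h0 : minor A m = 0
  · simpa [tauTerm, h0] using tendsto_const_nhds
  · have hb := (minor_ne_zero_iff A m).1 h0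
    refine tauTerm_div_tendsto hσ hF ?_ t c
    have hle := ha.2 _ hb
    rw [Finset.sum_map, Finset.sum_map] at hle
    refine lt_of_le_of_ne hle fun heq => hm ⟨hb, fun B' hB' => (ha.2 B' hB').trans ?_⟩
    rw [Finset.sum_map, Finset.sum_map]
    exact heq.ge

theorem solution_tendsto_zero {F : Filter ℝ} {σ s : ℝ} (hσ : σ * σ = 1)
    (hF : Tendsto (fun y => σ * y) F atTop) (hpos : IsPositive A k)
    (hbase : ∃ B, IsBase A.col B)
    (huniq : ∀ B B', IsMaxBase A.col (lineWeight k σ s) B →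
      IsMaxBase A.col (lineWeight k σ s) B' → B = B') (t c : ℝ) :
    Tendsto (fun z : ℝ × ℝ => solution A k θ₀ z.1 z.2 t) (lineStrip F s c) (𝓝 0) := by
  obtain ⟨B, hB⟩ := exists_isMaxBase hbase (lineWeight k σ s)
  obtain ⟨a, rfl⟩ := hB.1.exists_orderEmbedding
  have ha := (minor_ne_zero_iff A a).2 hB.1
  simp only [solution_eq hpos ⟨a, ha⟩]
  have hτ := fun z : ℝ × ℝ => tau_pos (θ₀ := θ₀) hpos ⟨a, ha⟩ z.1 z.2 t
  have h0 := fun m (z : ℝ × ℝ) =>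
    div_nonneg (tauTerm_nonneg (θ₀ := θ₀) hpos m z.1 z.2 t) (hτ z).le
  refine tendsto_variance_of_forall_ne (p := fun m (z : ℝ × ℝ) =>
    tauTerm A k θ₀ m z.1 z.2 t / tau A k θ₀ z.1 z.2 t) (a := a) h0
    (fun m z => div_le_one_of_le₀ (tauTerm_le_tau hpos m z.1 z.2 t) (hτ z).le) fun m hm => ?_
  refine squeeze_zero (h0 m) (fun z => ?_) (tauTerm_div_tendsto_of_isMaxBase (θ₀ := θ₀) hσ hF hB
    (fun h => hm (map_orderEmbedding_injective (huniq _ _ h hB))) t c)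
  exact div_le_div_of_nonneg_left (tauTerm_nonneg hpos m z.1 z.2 t)
    (tauTerm_pos hpos ha z.1 z.2 t) (tauTerm_le_tau hpos a z.1 z.2 t)

theorem one_div_cosh_half_sq (φ : ℝ) :
    (1 / Real.cosh (φ / 2)) ^ 2 = 4 * Real.exp φ / (1 + Real.exp φ) ^ 2 := by
  have h : Real.exp φ = Real.exp (φ / 2) ^ 2 := by rw [← Real.exp_nat_mul]; ring_nf
  rw [Real.cosh_eq, Real.exp_neg, h]
  have := Real.exp_pos (φ / 2)
  field_simp
  ring

theorem tau_div_tendsto {F : Filter ℝ} {σ s : ℝ} (hσ : σ * σ = 1)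
    (hF : Tendsto (fun y => σ * y) F atTop) (hpos : IsPositive A k) {a b : Fin N ↪o Fin M}
    (hab : a ≠ b) (ha : IsMaxBase A.col (lineWeight k σ s) (Finset.univ.map a.toEmbedding))
    (hb : IsMaxBase A.col (lineWeight k σ s) (Finset.univ.map b.toEmbedding))
    (h : ∀ C, IsMaxBase A.col (lineWeight k σ s) C →
      C = Finset.univ.map a.toEmbedding ∨ C = Finset.univ.map b.toEmbedding) (t c : ℝ) :
    Tendsto (fun z : ℝ × ℝ => tau A k θ₀ z.1 z.2 t /
        (tauTerm A k θ₀ a z.1 z.2 t + tauTerm A k θ₀ b z.1 z.2 t)) (lineStrip F s c) (𝓝 1) := by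
  have hTa := fun z : ℝ × ℝ =>
    tauTerm_pos (θ₀ := θ₀) hpos ((minor_ne_zero_iff A a).2 ha.1) z.1 z.2 t
  have hTb := fun z : ℝ × ℝ =>
    tauTerm_pos (θ₀ := θ₀) hpos ((minor_ne_zero_iff A b).2 hb.1) z.1 z.2 t
  have heq : ∀ z : ℝ × ℝ, 1 + ∑ m : Fin N ↪o Fin M, (if m = a ∨ m = b then 0 else
      tauTerm A k θ₀ m z.1 z.2 t /
        (tauTerm A k θ₀ a z.1 z.2 t + tauTerm A k θ₀ b z.1 z.2 t)) = tau A k θ₀ z.1 z.2 t /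
        (tauTerm A k θ₀ a z.1 z.2 t + tauTerm A k θ₀ b z.1 z.2 t) := by
    intro z
    have hne := (add_pos (hTa z) (hTb z)).ne'
    rw [tau, Finset.sum_div, ← Finset.add_sum_erase _ _ (Finset.mem_univ a),
      ← Finset.add_sum_erase _ _ (Finset.mem_erase.2 ⟨hab.symm, Finset.mem_univ b⟩),
      ← Finset.add_sum_erase (a := a) _ _ (Finset.mem_univ a),
      ← Finset.add_sum_erase (a := b) _ _ (Finset.mem_erase.2 ⟨hab.symm, Finset.mem_univ b⟩),
      ← add_assoc (_ / _) (_ / _), ← add_div, div_self hne]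
    simp only [true_or, or_true, if_true, zero_add]
    congr 1
    refine Finset.sum_congr rfl fun m hm => ?_
    rw [Finset.mem_erase, Finset.mem_erase] at hm
    rw [if_neg (by tauto)]
  have hterm : ∀ m : Fin N ↪o Fin M, Tendsto (fun z : ℝ × ℝ => if m = a ∨ m = b then 0 else
      tauTerm A k θ₀ m z.1 z.2 t /
        (tauTerm A k θ₀ a z.1 z.2 t + tauTerm A k θ₀ b z.1 z.2 t)) (lineStrip F s c) (𝓝 0) := by
    intro m
    split_ifs with hm
    · exact tendsto_const_nhds
    · refine squeeze_zero (fun z => div_nonneg (tauTerm_nonneg hpos m z.1 z.2 t)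
        (add_pos (hTa z) (hTb z)).le) (fun z => ?_)
        (tauTerm_div_tendsto_of_isMaxBase (θ₀ := θ₀) hσ hF ha (m := m) ?_ t c)
      · exact div_le_div_of_nonneg_left (tauTerm_nonneg hpos m z.1 z.2 t) (hTa z)
          (le_add_of_nonneg_right (hTb z).le)
      · intro hC
        rcases h _ hC with h | h
        · exact hm (Or.inl (map_orderEmbedding_injective h))
        · exact hm (Or.inr (map_orderEmbedding_injective h))
  have hsum := (tendsto_finsetSum Finset.univ fun m _ => hterm m).const_add 1
  rw [Finset.sum_const_zero, add_zero] at hsum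
  exact hsum.congr heq

theorem solution_sub_tendsto_zero {F : Filter ℝ} {σ s : ℝ} (hσ : σ * σ = 1)
    (hF : Tendsto (fun y => σ * y) F atTop) (hpos : IsPositive A k) {a b : Fin N ↪o Fin M}
    (hab : a ≠ b) (ha : IsMaxBase A.col (lineWeight k σ s) (Finset.univ.map a.toEmbedding))
    (hb : IsMaxBase A.col (lineWeight k σ s) (Finset.univ.map b.toEmbedding))
    (h : ∀ C, IsMaxBase A.col (lineWeight k σ s) C →
      C = Finset.univ.map a.toEmbedding ∨ C = Finset.univ.map b.toEmbedding) (t c : ℝ) :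
    Tendsto (fun z : ℝ × ℝ => solution A k θ₀ z.1 z.2 t -
        2 * (∑ n, k (a n) - ∑ n, k (b n)) ^ 2 *
          (tauTerm A k θ₀ a z.1 z.2 t * tauTerm A k θ₀ b z.1 z.2 t /
            (tauTerm A k θ₀ a z.1 z.2 t + tauTerm A k θ₀ b z.1 z.2 t) ^ 2))
      (lineStrip F s c) (𝓝 0) := by
  have ha0 := (minor_ne_zero_iff A a).2 ha.1
  have hTa := fun z : ℝ × ℝ => tauTerm_pos (θ₀ := θ₀) hpos ha0 z.1 z.2 t
  have hTb := fun z : ℝ × ℝ =>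
    tauTerm_pos (θ₀ := θ₀) hpos ((minor_ne_zero_iff A b).2 hb.1) z.1 z.2 t
  have hτ := fun z : ℝ × ℝ => tau_pos (θ₀ := θ₀) hpos ⟨a, ha0⟩ z.1 z.2 t
  have h0 := fun m (z : ℝ × ℝ) =>
    div_nonneg (tauTerm_nonneg (θ₀ := θ₀) hpos m z.1 z.2 t) (hτ z).le
  have hvar := tendsto_variance_sub_of_forall_ne (L := lineStrip F s c)
    (K := fun m : Fin N ↪o Fin M => ∑ n, k (m n)) (p := fun m (z : ℝ × ℝ) =>
    tauTerm A k θ₀ m z.1 z.2 t / tau A k θ₀ z.1 z.2 t) h0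
    (fun m z => div_le_one_of_le₀ (tauTerm_le_tau hpos m z.1 z.2 t) (hτ z).le) hab
    fun m hma hmb => by
      refine squeeze_zero (h0 m) (fun z => ?_) (tauTerm_div_tendsto_of_isMaxBase (θ₀ := θ₀) hσ hF ha
        (fun hC => (h _ hC).elim (fun h => hma (map_orderEmbedding_injective h))
          (fun h => hmb (map_orderEmbedding_injective h))) t c)
      exact div_le_div_of_nonneg_left (tauTerm_nonneg hpos m z.1 z.2 t) (hTa z)
        (tauTerm_le_tau hpos a z.1 z.2 t)
  have hratio := ((tau_div_tendsto (θ₀ := θ₀) hσ hF hpos hab ha hb h t c).inv₀ one_ne_zero).pow 2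
  -- The variance limit has `τ²` in the denominator. Passing to the square of the two-term sum costs
  -- a factor tending to 1, times a quotient bounded by 1.
  have hsmall : Tendsto (fun z : ℝ × ℝ =>
      tauTerm A k θ₀ a z.1 z.2 t * tauTerm A k θ₀ b z.1 z.2 t /
        (tauTerm A k θ₀ a z.1 z.2 t + tauTerm A k θ₀ b z.1 z.2 t) ^ 2 *
      ((tau A k θ₀ z.1 z.2 t /
        (tauTerm A k θ₀ a z.1 z.2 t + tauTerm A k θ₀ b z.1 z.2 t))⁻¹ ^ 2 - 1))
      (lineStrip F s c) (𝓝 0) := by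
    have hlim := (hratio.sub_const 1).norm
    simp only [inv_one, one_pow, sub_self, norm_zero] at hlim
    refine squeeze_zero_norm (fun z => ?_) hlim
    rw [norm_mul]
    refine mul_le_of_le_one_left (norm_nonneg _) ?_
    rw [Real.norm_of_nonneg (div_nonneg (mul_pos (hTa z) (hTb z)).le (sq_nonneg _))]
    refine div_le_one_of_le₀ ?_ (sq_nonneg _)
    nlinarith [hTa z, hTb z, mul_pos (hTa z) (hTb z)]
  have hsum := hvar.add (hsmall.const_mul (2 * (∑ n, k (a n) - ∑ n, k (b n)) ^ 2))
  rw [mul_zero, add_zero] at hsum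
  refine hsum.congr fun z => ?_
  rw [solution_eq hpos ⟨a, ha0⟩]
  have h1 := (hτ z).ne'
  have h2 := (add_pos (hTa z) (hTb z)).ne'
  field_simp
  ring

/-- The quotient of the two terms is `exp φ`, with `φ` equal to `θ_j - θ_i` plus the logarithm of
the quotient of their positive coefficients, and `exp φ / (1 + exp φ)²` is a quarter of `sech² (φ /
2)`. -/
theorem exists_soliton_profile (hpos : IsPositive A k) {a b : Fin N ↪o Fin M} {i j : Fin M}
    (ha0 : minor A a ≠ 0) (hb0 : minor A b ≠ 0)
    (hsum : ∀ g : Fin M → ℝ, ∑ n, g (b n) - ∑ n, g (a n) = g j - g i) :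
    ∃ δ : ℝ, ∀ x y t : ℝ, 2 * (∑ n, k (a n) - ∑ n, k (b n)) ^ 2 *
          (tauTerm A k θ₀ a x y t * tauTerm A k θ₀ b x y t /
            (tauTerm A k θ₀ a x y t + tauTerm A k θ₀ b x y t) ^ 2) =
      (k j - k i) ^ 2 / 2 * (1 / Real.cosh (phaseDiff (k i) (k j) δ x y t / 2)) ^ 2 := by
  set d : (Fin N ↪o Fin M) → ℝ := fun m =>
    minor A m * ∏ s : Fin N, ∏ r ∈ Finset.Ioi s, (k (m r) - k (m s)) with hd
  have hT : ∀ m x y t, tauTerm A k θ₀ m x y t = d m * Real.exp (∑ n, phase k θ₀ (m n) x y t) :=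
    fun m x y t => by simp only [tauTerm, hd]; ring
  have hdpos : ∀ m, minor A m ≠ 0 → 0 < d m := fun m hm => by
    have := tauTerm_pos (θ₀ := θ₀) hpos hm 0 0 0
    rw [hT] at this
    exact pos_of_mul_pos_left this (Real.exp_pos _).le
  have hda := hdpos a ha0
  have hdb := hdpos b hb0
  refine ⟨θ₀ j - θ₀ i + Real.log (d b / d a), fun x y t => ?_⟩
  have hexp : tauTerm A k θ₀ b x y t = tauTerm A k θ₀ a x y t *
      Real.exp (phaseDiff (k i) (k j) (θ₀ j - θ₀ i + Real.log (d b / d a)) x y t) := by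
    have hph := hsum fun m => phase k θ₀ m x y t
    have : phaseDiff (k i) (k j) (θ₀ j - θ₀ i + Real.log (d b / d a)) x y t =
        ∑ n, phase k θ₀ (b n) x y t - ∑ n, phase k θ₀ (a n) x y t + Real.log (d b / d a) := by
      rw [hph, phaseDiff, phase, phase]; ring
    rw [this, Real.exp_add, Real.exp_sub, Real.exp_log (div_pos hdb hda), hT, hT]
    have := Real.exp_pos (∑ n, phase k θ₀ (a n) x y t)
    field_simp
  have hTa := tauTerm_pos (θ₀ := θ₀) hpos ha0 x y t
  have hk : (∑ n, k (a n) - ∑ n, k (b n)) ^ 2 = (k j - k i) ^ 2 := by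
    rw [← hsum k]; ring
  rw [one_div_cosh_half_sq, hexp, hk]
  have := Real.exp_pos (phaseDiff (k i) (k j) (θ₀ j - θ₀ i + Real.log (d b / d a)) x y t)
  field_simp
  ring

/-! ### Ties between weights, and the columns heavier than a tied pair. -/

theorem IsIrreducible.exists_isBase (hirr : IsIrreducible A) (hrref : IsRREF A) :
    ∃ B, IsBase A.col B := by
  obtain ⟨e, he⟩ := hirr.exists_pivot hrref
  exact ⟨_, (minor_ne_zero_iff A e).1 (by rw [minor_pivot hrref he]; exact one_ne_zero)⟩

/-- The difference of the weights factors as `σ (k_m - k_f)(k_m + k_f - s)`. -/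
theorem lineWeight_eq_iff (hk : StrictMono k) {σ s : ℝ} (hσ : σ * σ = 1) {m f : Fin M} :
    lineWeight k σ s m = lineWeight k σ s f ↔ m = f ∨ k m + k f = s := by
  have h0 : σ ≠ 0 := by rintro rfl; simp at hσ
  rw [lineWeight, lineWeight, mul_right_inj' h0, ← sub_eq_zero,
    show k m ^ 2 - s * k m - (k f ^ 2 - s * k f) = (k m - k f) * (k m + k f - s) by ring,
    mul_eq_zero, sub_eq_zero, sub_eq_zero, hk.injective.eq_iff]

theorem tiesOnly_lineWeight (hk : StrictMono k) (hgen : IsGeneric k) {σ : ℝ} (hσ : σ * σ = 1)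
    {i j : Fin M} (hij : i < j) : TiesOnly (lineWeight k σ (k i + k j)) i j := by
  refine ⟨hij.ne, (lineWeight_eq_iff hk hσ).2 (Or.inr rfl), fun f hi hj m hm heq => ?_⟩
  have hs := ((lineWeight_eq_iff hk hσ).1 heq).resolve_left hm
  rcases lt_or_gt_of_ne hm with h | h
  · exact hj (hgen m f i j h hij hs).2
  · exact hi (hgen f m i j h hij (by rw [add_comm, hs])).1

theorem lineWeight_injective (hk : StrictMono k) {σ s : ℝ} (hσ : σ * σ = 1)
    (hs : ∀ i j, i < j → k i + k j ≠ s) : Function.Injective (lineWeight k σ s) := by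
  intro m f heq
  rcases (lineWeight_eq_iff hk hσ).1 heq with h | h
  · exact h
  · by_contra hne
    rcases lt_or_gt_of_ne hne with hlt | hlt
    · exact hs m f hlt h
    · exact hs f m hlt (by rw [add_comm, h])

theorem lineWeight_sub (σ : ℝ) (i j m : Fin M) :
    lineWeight k σ (k i + k j) m - lineWeight k σ (k i + k j) i =
      σ * ((k m - k i) * (k m - k j)) := by
  rw [lineWeight, lineWeight]; ring

theorem setOf_lineWeight_lt_one (hk : StrictMono k) {i j : Fin M} (hij : i < j) :
    {m | lineWeight k 1 (k i + k j) i < lineWeight k 1 (k i + k j) m} = outerColumns i j := by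
  ext m
  rw [coe_outerColumns, Set.mem_ofPred_eq, ← sub_pos, lineWeight_sub, one_mul, mul_pos_iff,
    sub_pos, sub_pos, sub_neg, sub_neg, hk.lt_iff_lt, hk.lt_iff_lt, hk.lt_iff_lt, hk.lt_iff_lt]
  simp only [Set.mem_union, Set.mem_Iio, Set.mem_Ioi]
  exact ⟨fun h => h.elim (fun h => Or.inr h.2) fun h => Or.inl h.1,
    fun h => h.elim (fun h => Or.inr ⟨h, h.trans hij⟩) fun h => Or.inl ⟨hij.trans h, h⟩⟩

theorem setOf_lineWeight_lt_neg_one (hk : StrictMono k) {i j : Fin M} (hij : i < j) :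
    {m | lineWeight k (-1) (k i + k j) i < lineWeight k (-1) (k i + k j) m} =
      innerColumns i j := by
  ext m
  rw [coe_innerColumns, Set.mem_ofPred_eq, ← sub_pos, lineWeight_sub, neg_one_mul, neg_pos,
    mul_neg_iff, sub_pos, sub_pos, sub_neg, sub_neg, hk.lt_iff_lt, hk.lt_iff_lt, hk.lt_iff_lt,
    hk.lt_iff_lt, Set.mem_Ioo]
  exact ⟨fun h => h.elim id fun h => absurd (h.1.trans hij) h.2.not_gt, Or.inl⟩

/-! ### Solitons contained in `u` and the span condition. -/

theorem phaseDiff_eq {p q : ℝ} (δ x y t : ℝ) :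
    phaseDiff p q δ x y t = (q - p) * (x + (p + q) * y) + ((q ^ 3 - p ^ 3) * t + δ) := by
  rw [phaseDiff]; ring

/-- The value of the soliton profile on the line `x + (p + q) y = ξ` at time `0` is a limit of
`u` along that line. -/
theorem tendsto_solution_curve {u : ℝ → ℝ → ℝ → ℝ} {F : Filter ℝ} {p q δ : ℝ}
    (h : ∀ R : ℝ, Tendsto (fun z : ℝ × ℝ => u z.1 z.2 0 -
        (q - p) ^ 2 / 2 * (1 / Real.cosh (phaseDiff p q δ z.1 z.2 0 / 2)) ^ 2)
      (strip F (fun x y => phaseDiff p q δ x y 0) R) (𝓝 0)) (ξ : ℝ) :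
    Tendsto (fun y => u (-(p + q) * y + ξ) y 0) F
      (𝓝 ((q - p) ^ 2 / 2 * (1 / Real.cosh (((q - p) * ξ + δ) / 2)) ^ 2)) := by
  have hconst : ∀ y, phaseDiff p q δ (-(p + q) * y + ξ) y 0 = (q - p) * ξ + δ := fun y => by
    rw [phaseDiff]; ring
  have hlim := (h |(q - p) * ξ + δ|).comp (tendsto_curve_strip (F := F) (s := p + q) (ξ := ξ)
    (ϑ := fun x y => phaseDiff p q δ x y 0) fun y => (congrArg abs (hconst y)).le)
  have := hlim.add_const ((q - p) ^ 2 / 2 * (1 / Real.cosh (((q - p) * ξ + δ) / 2)) ^ 2)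
  rw [zero_add] at this
  refine this.congr fun y => ?_
  simp only [Function.comp_apply, hconst]
  ring

theorem one_div_cosh_sq_le_one (φ : ℝ) : (1 / Real.cosh φ) ^ 2 ≤ 1 := by
  have h := Real.one_le_cosh φ
  refine pow_le_one₀ (by positivity) ?_
  rw [div_le_one (by positivity)]
  exact h

theorem isAsymptoticLineSoliton_of_spanCondition {F : Filter ℝ} {σ : ℝ} (hσ : σ * σ = 1)
    (hF : Tendsto (fun y => σ * y) F atTop) (hpos : IsPositive A k) (hgen : IsGeneric k)
    (hbase : ∃ B, IsBase A.col B) {i j : Fin M} (hij : i < j)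
    (hc : SpanCondition A.col
      {m | lineWeight k σ (k i + k j) i < lineWeight k σ (k i + k j) m} i j) :
    IsAsymptoticLineSoliton A k θ₀ F i j := by
  have ht := tiesOnly_lineWeight hpos.strictMono hgen hσ hij
  obtain ⟨B, B', hB, hB', hi, hj, hi', hj'⟩ := (spanCondition_iff_exists_isMaxBase hbase ht).1 hc
  have hor : ∀ C, IsMaxBase A.col (lineWeight k σ (k i + k j)) C → C = B ∨ C = B' :=
    fun C hC => hB.eq_or_eq ht hB' hi hi' hC
  obtain ⟨S, hiS, hjS, hBS, hBS'⟩ := hB.exists_eq_insert ht hB' hi hj hi' hj'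
  obtain ⟨a, rfl⟩ := hB.1.exists_orderEmbedding
  obtain ⟨b, rfl⟩ := hB'.1.exists_orderEmbedding
  have ha0 := (minor_ne_zero_iff A a).2 hB.1
  have hb0 := (minor_ne_zero_iff A b).2 hB'.1
  have hab : a ≠ b := by
    rintro rfl
    exact hi' hi
  have hsum : ∀ g : Fin M → ℝ, ∑ n, g (b n) - ∑ n, g (a n) = g j - g i := by
    intro g
    have h1 := Finset.sum_map Finset.univ a.toEmbedding g
    have h2 := Finset.sum_map Finset.univ b.toEmbedding g
    rw [hBS, Finset.sum_insert hiS] at h1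
    rw [hBS', Finset.sum_insert hjS] at h2
    simp only [RelEmbedding.coe_toEmbedding] at h1 h2
    rw [← h1, ← h2]
    ring
  have hkij : k i < k j := hpos.strictMono hij
  refine ⟨hij, ⟨S, a, b, hiS, hjS, ?_, ?_, ha0, hb0, fun t R => ?_⟩, hkij, ?_⟩
  · simpa using congrArg (fun B : Finset (Fin M) => (B : Set (Fin M))) hBS
  · simpa using congrArg (fun B : Finset (Fin M) => (B : Set (Fin M))) hBS'
  · refine (tau_div_tendsto hσ hF hpos hab hB hB' hor t _).mono_left
      (strip_le_lineStrip (a := k i - k j) (b := (k i ^ 3 - k j ^ 3) * t + (θ₀ i - θ₀ j))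
        (sub_neg.2 hkij).ne (fun x y => ?_) R)
    rw [phase, phase]; ring
  · obtain ⟨δ, hδ⟩ := exists_soliton_profile (θ₀ := θ₀) hpos ha0 hb0 hsum
    refine ⟨δ, fun t R => ?_⟩
    have := solution_sub_tendsto_zero (θ₀ := θ₀) hσ hF hpos hab hB hB' hor t
      ((R + |(k j ^ 3 - k i ^ 3) * t + δ|) / |k j - k i|)
    simp only [hδ] at this
    exact this.mono_left (strip_le_lineStrip (sub_pos.2 hkij).ne'
      (fun x y => phaseDiff_eq δ x y t) R)

theorem spanCondition_of_hasLineSoliton {F : Filter ℝ} [F.NeBot] {σ : ℝ} (hσ : σ * σ = 1)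
    (hF : Tendsto (fun y => σ * y) F atTop) (hpos : IsPositive A k) (hgen : IsGeneric k)
    (hbase : ∃ B, IsBase A.col B) {p q : ℝ} (hu : HasLineSoliton (solution A k θ₀) F p q) :
    ∃ i j, i < j ∧ k i = p ∧ k j = q ∧ SpanCondition A.col
      {m | lineWeight k σ (k i + k j) i < lineWeight k σ (k i + k j) m} i j := by
  obtain ⟨hpq, δ, hδ⟩ := hu
  have hcurve := tendsto_solution_curve (hδ 0)
  -- This value of `ξ` is the crest of the soliton, where `sech²` equals 1 and the limit of `u` is
  -- `(q - p)² / 2`. It is nonzero, so the best basis for `s = p + q` cannot be unique.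
  have hpeak := hcurve (-δ / (q - p))
  have hqp : q - p ≠ 0 := (sub_pos.2 hpq).ne'
  rw [mul_div_cancel₀ _ hqp, neg_add_cancel, zero_div, Real.cosh_zero] at hpeak
  have hunique : ¬ ∀ B B', IsMaxBase A.col (lineWeight k σ (p + q)) B →
      IsMaxBase A.col (lineWeight k σ (p + q)) B' → B = B' := by
    intro h
    have h0 := (solution_tendsto_zero (θ₀ := θ₀) hσ hF hpos hbase h 0 |-δ / (q - p)|).comp
      (tendsto_curve_strip (F := F) (s := p + q) (ξ := -δ / (q - p))
        (ϑ := fun x y => x + (p + q) * y) fun y => (congrArg abs (by ring)).le)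
    have := tendsto_nhds_unique h0 hpeak
    have : 0 < (q - p) ^ 2 := by positivity
    linarith
  by_cases hs : ∀ i j, i < j → k i + k j ≠ p + q
  · exact absurd (fun B B' hB hB' => IsMaxBase.eq_of_injective
      (lineWeight_injective hpos.strictMono hσ hs) hB hB') hunique
  push Not at hs
  obtain ⟨i, j, hij, hs⟩ := hs
  rw [← hs] at hunique
  have ht := tiesOnly_lineWeight hpos.strictMono hgen hσ hij
  have hc : SpanCondition A.col
      {m | lineWeight k σ (k i + k j) i < lineWeight k σ (k i + k j) m} i j := by
    by_contra hc
    rw [spanCondition_iff_exists_isMaxBase hbase ht] at hc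
    refine hunique fun B B' hB hB' => ?_
    by_contra hne
    rcases hB.exchange ht hB' hne with h | h
    · exact hc ⟨B, B', hB, hB', h.1, h.2.1, h.2.2.1, h.2.2.2⟩
    · exact hc ⟨B', B, hB', hB, h.2.2.2, h.2.2.1, h.2.1, h.1⟩
  have hkij : 0 < k j - k i := sub_pos.2 (hpos.strictMono hij)
  -- Now `u` contains both `(p, q)` and `(k_i, k_j)` along parallel lines. Evaluating each profile
  -- at the other's crest bounds each amplitude by the other; equal differences and equal sums then
  -- give equal parameters.
  obtain ⟨-, -, -, δ', hδ'⟩ :=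
    isAsymptoticLineSoliton_of_spanCondition (θ₀ := θ₀) hσ hF hpos hgen hbase hij hc
  have hcurve' := tendsto_solution_curve (hδ' 0)
  rw [hs] at hcurve'
  have h1 := tendsto_nhds_unique (hcurve' (-δ / (q - p))) hpeak
  have hpeak' := hcurve' (-δ' / (k j - k i))
  rw [mul_div_cancel₀ _ hkij.ne', neg_add_cancel, zero_div, Real.cosh_zero] at hpeak'
  have h2 := tendsto_nhds_unique (hcurve (-δ' / (k j - k i))) hpeak'
  have hle1 := mul_le_mul_of_nonneg_left (one_div_cosh_sq_le_one
    (((k j - k i) * (-δ / (q - p)) + δ') / 2)) (by positivity : 0 ≤ (k j - k i) ^ 2 / 2)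
  have hle2 := mul_le_mul_of_nonneg_left (one_div_cosh_sq_le_one
    (((q - p) * (-δ' / (k j - k i)) + δ) / 2)) (by positivity : 0 ≤ (q - p) ^ 2 / 2)
  have hsq : (k j - k i) ^ 2 = (q - p) ^ 2 := by
    rw [h1] at hle1
    rw [h2] at hle2
    linarith
  have hd : k j - k i = q - p :=
    (pow_left_inj₀ hkij.le (sub_pos.2 hpq).le two_ne_zero).1 hsq
  exact ⟨i, j, hij, by linarith, by linarith, hc⟩

/-- The profile alone already forces the span condition, which in turn yields the single-phase
transition. -/
theorem isAsymptoticLineSoliton_iff {F : Filter ℝ} [F.NeBot] {σ : ℝ} (hσ : σ * σ = 1)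
    (hF : Tendsto (fun y => σ * y) F atTop) (hpos : IsPositive A k) (hgen : IsGeneric k)
    (hbase : ∃ B, IsBase A.col B) {i j : Fin M} (hij : i < j) :
    IsAsymptoticLineSoliton A k θ₀ F i j ↔ SpanCondition A.col
      {m | lineWeight k σ (k i + k j) i < lineWeight k σ (k i + k j) m} i j := by
  refine ⟨fun h => ?_, isAsymptoticLineSoliton_of_spanCondition hσ hF hpos hgen hbase hij⟩
  obtain ⟨i', j', -, hi, hj, hc⟩ := spanCondition_of_hasLineSoliton hσ hF hpos hgen hbase h.2.2
  rwa [hpos.strictMono.injective hi, hpos.strictMono.injective hj] at hc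

theorem existsUnique_isAsymptoticLineSoliton {F : Filter ℝ} [F.NeBot] {σ : ℝ} (hσ : σ * σ = 1)
    (hF : Tendsto (fun y => σ * y) F atTop) (hpos : IsPositive A k) (hgen : IsGeneric k)
    (hbase : ∃ B, IsBase A.col B) {p q : ℝ} (hu : HasLineSoliton (solution A k θ₀) F p q) :
    ∃! ij : Fin M × Fin M, IsAsymptoticLineSoliton A k θ₀ F ij.1 ij.2 ∧
      k ij.1 = p ∧ k ij.2 = q := by
  obtain ⟨i, j, hij, hi, hj, hc⟩ := spanCondition_of_hasLineSoliton hσ hF hpos hgen hbase hu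
  refine ⟨(i, j), ⟨isAsymptoticLineSoliton_of_spanCondition hσ hF hpos hgen hbase hij hc, hi, hj⟩,
    fun ij h => Prod.ext ?_ ?_⟩
  · exact hpos.strictMono.injective (h.2.1.trans hi.symm)
  · exact hpos.strictMono.injective (h.2.2.trans hj.symm)

end KPII

/-! ### Assembly for both directions of `y`. -/

theorem proposition2 {N M : ℕ} (A : Matrix (Fin N) (Fin M) ℝ) (k θ₀ : Fin M → ℝ)
    (hrref : KPII.IsRREF A) (hpos : KPII.IsPositive A k) (hirr : KPII.IsIrreducible A)
    (hgen : KPII.IsGeneric k) :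
    -- outgoing solitons are labelled by unique pairs `[e_n, j_n]`, one for each pivot column
    ((∀ p q : ℝ, KPII.HasLineSoliton (KPII.solution A k θ₀) atTop p q →
        ∃! ij : Fin M × Fin M, KPII.IsAsymptoticLineSoliton A k θ₀ atTop ij.1 ij.2 ∧
          k ij.1 = p ∧ k ij.2 = q) ∧
      (∀ i j, KPII.IsAsymptoticLineSoliton A k θ₀ atTop i j → KPII.IsPivotColumn A i) ∧
      (∀ e, KPII.IsPivotColumn A e → ∃! j, KPII.IsAsymptoticLineSoliton A k θ₀ atTop e j) ∧
      {ij : Fin M × Fin M | KPII.IsAsymptoticLineSoliton A k θ₀ atTop ij.1 ij.2}.encard = N) ∧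
    -- incoming solitons are labelled by unique pairs `[i_n, g_n]`, one for each non-pivot column
    ((∀ p q : ℝ, KPII.HasLineSoliton (KPII.solution A k θ₀) atBot p q →
        ∃! ij : Fin M × Fin M, KPII.IsAsymptoticLineSoliton A k θ₀ atBot ij.1 ij.2 ∧
          k ij.1 = p ∧ k ij.2 = q) ∧
      (∀ i j, KPII.IsAsymptoticLineSoliton A k θ₀ atBot i j → ¬ KPII.IsPivotColumn A j) ∧
      (∀ g, ¬ KPII.IsPivotColumn A g →
        ∃! i, KPII.IsAsymptoticLineSoliton A k θ₀ atBot i g) ∧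
      {ij : Fin M × Fin M | KPII.IsAsymptoticLineSoliton A k θ₀ atBot ij.1 ij.2}.encard
        = (M - N : ℕ)) ∧
    -- the rank conditions
    (∀ i j : Fin M, i < j →
      (KPII.IsAsymptoticLineSoliton A k θ₀ atTop i j ↔
        KPII.RankCondition A (KPII.outerColumns i j) i j) ∧
      (KPII.IsAsymptoticLineSoliton A k θ₀ atBot i j ↔
        KPII.RankCondition A (KPII.innerColumns i j) i j)) := by
  have hbase := hirr.exists_isBase hrref
  have hk := hpos.strictMono
  -- The sign `σ` is `1` for `y → ∞` and `-1` for `y → -∞`, so that `σ y → ∞` in both cases.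
  have hσ : (1 : ℝ) * 1 = 1 := one_mul 1
  have hσ' : (-1 : ℝ) * -1 = 1 := by norm_num
  have hF : Tendsto (fun y : ℝ => 1 * y) atTop atTop :=
    tendsto_id.congr fun y => (one_mul y).symm
  have hF' : Tendsto (fun y : ℝ => -1 * y) atBot atTop := by
    simpa using tendsto_neg_atBot_atTop
  have htop : ∀ i j : Fin M, i < j → (KPII.IsAsymptoticLineSoliton A k θ₀ atTop i j ↔
      KPII.RankCondition A (KPII.outerColumns i j) i j) := fun i j hij => by
    rw [KPII.isAsymptoticLineSoliton_iff hσ hF hpos hgen hbase hij, KPII.rankCondition_iff,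
      KPII.setOf_lineWeight_lt_one hk hij]
  have hbot : ∀ i j : Fin M, i < j → (KPII.IsAsymptoticLineSoliton A k θ₀ atBot i j ↔
      KPII.RankCondition A (KPII.innerColumns i j) i j) := fun i j hij => by
    rw [KPII.isAsymptoticLineSoliton_iff hσ' hF' hpos hgen hbase hij, KPII.rankCondition_iff,
      KPII.setOf_lineWeight_lt_neg_one hk hij]
  have htop1 : ∀ i j, KPII.IsAsymptoticLineSoliton A k θ₀ atTop i j → KPII.IsPivotColumn A i :=
    fun i j h => KPII.isPivotColumn_of_rankCondition_outer hrref hirr ((htop i j h.1).1 h)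
  have hbot1 : ∀ i j, KPII.IsAsymptoticLineSoliton A k θ₀ atBot i j → ¬ KPII.IsPivotColumn A j :=
    fun i j h => KPII.not_isPivotColumn_of_rankCondition_inner hrref hirr h.1 ((hbot i j h.1).1 h)
  have htop2 : ∀ e, KPII.IsPivotColumn A e →
      ∃! j, KPII.IsAsymptoticLineSoliton A k θ₀ atTop e j := fun e he => by
    refine (existsUnique_congr fun j => ?_).1 (KPII.existsUnique_rankCondition_outer hrref hirr he)
    exact ⟨fun h => (htop e j h.1).2 h.2, fun h => ⟨h.1, (htop e j h.1).1 h⟩⟩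
  have hbot2 : ∀ g, ¬ KPII.IsPivotColumn A g →
      ∃! i, KPII.IsAsymptoticLineSoliton A k θ₀ atBot i g := fun g hg => by
    refine (existsUnique_congr fun i => ?_).1 (KPII.existsUnique_rankCondition_inner hrref hirr hg)
    exact ⟨fun h => (hbot i g h.1).2 h.2, fun h => ⟨h.1, (hbot i g h.1).1 h⟩⟩
  refine ⟨⟨fun p q h => KPII.existsUnique_isAsymptoticLineSoliton hσ hF hpos hgen hbase h,
    htop1, htop2, ?_⟩, ⟨fun p q h => KPII.existsUnique_isAsymptoticLineSoliton hσ' hF' hpos hgen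
      hbase h, hbot1, hbot2, ?_⟩, fun i j hij => ⟨htop i j hij, hbot i j hij⟩⟩
  · rw [KPII.encard_setOf_prod_eq_fst htop1 htop2, KPII.encard_isPivotColumn hrref hirr]
  · rw [KPII.encard_setOf_prod_eq_snd hbot1 hbot2, KPII.encard_not_isPivotColumn hrref hirr]
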